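/- \textbf{Gibbs conditional principle in variation norm.} Let $X_1,X_2,\dots$ be independent real random variables with common law $P$ having a bounded density $p$ with respect to Lebesgue measure, and suppose that $\phi(t)=E\,e^{tX_1}$ is finite in a neighbourhood of $0$. Suppose that $$p(x)=c\exp\bigl(-(g(x)-q(x))\bigr)\qquad(x>0),$$ where $c>0$, the function $g$ is positive and differentiable on $(0,\infty)$ with derivative $h=g'$, $g(x)/x\to\infty$ as $x\to\infty$, and, for some $\vartheta>0$ and all sufficiently large $x$, $$\sup_{v>0,\ |v-x|<\vartheta x}|q(v)|\le \frac1{\sqrt{x\,h(x)}} .$$ Say that $l\in R_0$ (with function $\varepsilon$) if $l(x)=\exp\bigl(\int_1^x\varepsilon(u)\,du/u\bigr)$ for $x\ge1$, where $\varepsilon$ is twice differentiable on $[1,\infty)$ and $\varepsilon(x)\to0$ as $x\to\infty$. Put $\psi(u)=\inf\{x>0: h(x)\ge u\}$, and assume that $h\in\bigcup_{\beta>0}R_\beta\cup R_\infty$, where - $h\in R_\beta$ ($\beta>0$) means that, for all large $x$, $h(x)=x^\beta l(x)$ with $l\in R_0$, $\limsup_{x\to\infty} x|\varepsilon'(x)|<\infty$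 and $\limsup_{x\to\infty} x^2|\varepsilon''(x)|<\infty$; - $h\in R_\infty$ means that $h$ is strictly increasing on $(0,\infty)$ and $\psi\in R_0$ with $\psi(x)\to\infty$, $x\varepsilon'(x)/\varepsilon(x)\to0$, $x^2\varepsilon''(x)/\varepsilon(x)\to0$ as $x\to\infty$, and $\liminf_{x\to\infty}x^\eta\varepsilon(x)>0$ for some $\eta\in(0,1/4)$. Let $m(t)=\frac{d}{dt}\log\phi(t)$ on the interior of $\{\phi<\infty\}$. For $a$ in the range of $m$ let $\Pi^a$ be the tilted distribution with density $\pi^a(x)=e^{tx}p(x)/\phi(t)$, where $m(t)=a$. With $p^{*k}$ the $k$-fold convolution of $p$, for $n\ge2$ and $a>0$ let $$p_{a}(x)=\frac{p(x)\,p^{*(n-1)}(na-x)}{p^{*n}(na)}$$ be the conditional density of $X_1$ given $S_1^n=X_1+\dots+X_n=na$, and $P_{a}$ the conditional law with this density ($p_a$ and $P_a$ depend on $n$). Let $a_n\to\infty$. For large $n$ the equation $m(t_n)=a_n$ has exactly one solution $t_n$ and the distributions $\Pi^{a_n}$ and $P_{a_n}$ are well defined. Assume the growth condition $$\lim_{n\to\infty}\frac{\psi(t_n)^2}{\sqrt{n\,\psi'(t_n)}}=0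 .$$ Then, as $n\to\infty$, $$\sup_{C\in\mathcal B(\mathbb R)}\bigl|P_{a_n}(C)-\Pi^{a_n}(C)\bigr|\longrightarrow0,\qquad\text{and equivalently}\qquad \int_{\mathbb R}\bigl|p_{a_n}(x)-\pi^{a_n}(x)\bigr|\,dx\longrightarrow0 .$$ -/

import Mathlib

open MeasureTheory ProbabilityTheory Filter Topology Set

noncomputable section

namespace GibbsED

/-! ### The regularity classes -/

/-- `l(x) = exp (∫₁ˣ ε(u)/u du)` for `x ≥ 1`, where `ε` is twice differentiable on `[1, ∞)` and
`ε(x) → 0` as `x → ∞`. -/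
structure IsR0Rep (l ε : ℝ → ℝ) : Prop where
  diff : DifferentiableOn ℝ ε (Ici 1)
  diff_two : DifferentiableOn ℝ (derivWithin ε (Ici 1)) (Ici 1)
  tendsto_zero : Tendsto ε atTop (𝓝 0)
  rep : ∀ x, 1 ≤ x → l x = Real.exp (∫ u in (1 : ℝ)..x, ε u / u)

/-- The class `R_β` (`β > 0`): for large `x`, `h(x) = x^β l(x)` with `l` as above,
`limsup x |ε'(x)| < ∞` and `limsup x² |ε''(x)| < ∞`. -/
def ClassRBeta (β : ℝ) (h : ℝ → ℝ) : Prop :=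
  0 < β ∧ ∃ l ε : ℝ → ℝ, IsR0Rep l ε ∧
    IsBoundedUnder (· ≤ ·) atTop (fun x => x * |deriv ε x|) ∧
    IsBoundedUnder (· ≤ ·) atTop (fun x => x ^ 2 * |deriv (deriv ε) x|) ∧
    ∀ᶠ x in atTop, h x = x ^ β * l x

/-- The class `R̃₀` of slowly varying functions; the last conjunct says that
`liminf x^η ε(x) > 0` for some `η ∈ (0, 1/4)`. -/
def ClassR0Tilde (l : ℝ → ℝ) : Prop :=
  ∃ ε : ℝ → ℝ, IsR0Rep l ε ∧ Tendsto l atTop atTop ∧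
    Tendsto (fun x => x * deriv ε x / ε x) atTop (𝓝 0) ∧
    Tendsto (fun x => x ^ 2 * deriv (deriv ε) x / ε x) atTop (𝓝 0) ∧
    ∃ η : ℝ, 0 < η ∧ η < 1 / 4 ∧ ∃ δ : ℝ, 0 < δ ∧ ∀ᶠ x in atTop, δ ≤ x ^ η * ε x

/-- The generalized inverse `ψ(u) = inf {x > 0 : h(x) ≥ u}` of a function `h` on `(0, ∞)`. -/
def psi (h : ℝ → ℝ) (u : ℝ) : ℝ := sInf {x | 0 < x ∧ u ≤ h x}

/-- The class `R_∞`. -/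
def ClassRInfty (h : ℝ → ℝ) : Prop :=
  StrictMonoOn h (Ioi 0) ∧ ClassR0Tilde (psi h)

/-- The class `ℜ = R_β ∪ R_∞`. -/
def ClassR (h : ℝ → ℝ) : Prop := (∃ β, ClassRBeta β h) ∨ ClassRInfty h

/-! ### The distribution of the summands -/

/-- The distribution `P_X` with density `p` with respect to Lebesgue measure. -/
def law (p : ℝ → ℝ) : Measure ℝ := volume.withDensity fun x => ENNReal.ofReal (p x)

/-- The standing assumptions on the density `p` of `X₁`: it is bounded, it has a finite moment
generating function near `0`, and `p(x) = c exp (-(g(x) - q(x)))` for `x > 0`, where `g' ∈ ℜ`. -/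
structure IsLightTail (p g q : ℝ → ℝ) (c : ℝ) : Prop where
  measurable : Measurable p
  nonneg : ∀ x, 0 ≤ p x
  isProbabilityMeasure : IsProbabilityMeasure (law p)
  bounded : ∃ M, ∀ x, p x ≤ M
  cramer : (0 : ℝ) ∈ interior (integrableExpSet id (law p))
  c_pos : 0 < c
  density_eq : ∀ x, 0 < x → p x = c * Real.exp (-(g x - q x))
  g_diff : DifferentiableOn ℝ g (Ioi 0)
  g_pos : ∀ x, 0 < x → 0 < g x
  g_superlinear : Tendsto (fun x => g x / x) atTop atTop
  q_small : ∃ θ : ℝ, 0 < θ ∧ ∀ᶠ x in atTop,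
    ∀ v, 0 < v → |v - x| < θ * x → |q v| ≤ 1 / √(x * deriv g x)
  regular : ClassR (deriv g)

/-! ### Tilting -/

/-- The interior of the set of all `t` with `φ(t) = E exp (t X₁) < ∞`. -/
def tiltDomain (p : ℝ → ℝ) : Set ℝ := interior (integrableExpSet id (law p))

/-- `m(t) = (d/dt) log φ(t)`. -/
def tiltMean (p : ℝ → ℝ) (t : ℝ) : ℝ := deriv (cgf id (law p)) t

/-- The solution `t` of `m(t) = a` (an arbitrary number if there is none). -/
def tiltParam (p : ℝ → ℝ) (a : ℝ) : ℝ := Function.invFunOn (tiltMean p) (tiltDomain p) a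

/-- The tilted density `π^a(x) = exp (t x) p(x) / φ(t)`, where `m(t) = a`. -/
def tiltedDensity (p : ℝ → ℝ) (a x : ℝ) : ℝ :=
  Real.exp (tiltParam p a * x) / mgf id (law p) (tiltParam p a) * p x

/-- The tilted distribution `Π^a`. -/
def tiltedLaw (p : ℝ → ℝ) (a : ℝ) : Measure ℝ := law (tiltedDensity p a)

/-! ### Conditioning on the value of the sum -/

/-- The density of `S₁ⁿ = X₁ + ⋯ + Xₙ` for independent `X₁, …, Xₙ` with density `p` and `n ≥ 1`:
the `n`-fold convolution `p * ⋯ * p` (there is no density for `n = 0`; the value is junk). -/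
def sumDensity (p : ℝ → ℝ) : ℕ → ℝ → ℝ
  | 0 => fun _ => 0
  | 1 => p
  | n + 2 => convolution p (sumDensity p (n + 1)) (ContinuousLinearMap.mul ℝ ℝ) volume

/-- The joint density of `(X₁, S₁ⁿ)` at `(x, s)`, for `n ≥ 2`: since `S₁ⁿ - X₁` is independent of
`X₁` and is a sum of `n - 1` variables, it is `p(x) p^{*(n-1)}(s - x)`. -/
def jointDensity (p : ℝ → ℝ) (n : ℕ) (x s : ℝ) : ℝ := p x * sumDensity p (n - 1) (s - x)

/-- The conditional density `p_a` of `X₁` given `S₁ⁿ = n a`: the joint density of `(X₁, S₁ⁿ)` at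
`(x, n a)` divided by the density of `S₁ⁿ` at `n a`. -/
def condDensity (p : ℝ → ℝ) (n : ℕ) (a x : ℝ) : ℝ :=
  jointDensity p n x (n * a) / sumDensity p n (n * a)

/-- The conditional distribution of `X₁` given `S₁ⁿ = n a`. -/
def condLaw (p : ℝ → ℝ) (n : ℕ) (a : ℝ) : Measure ℝ := law (condDensity p n a)

/-- The total variation distance `sup_C |μ(C) - ν(C)|` over Borel sets `C` (for finite measures). -/
def tvDist (μ ν : Measure ℝ) : ℝ :=
  ⨆ C : {C : Set ℝ // MeasurableSet C}, |μ.real C - ν.real C|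

end GibbsED

end

/-!
# The Gibbs conditional principle in variation norm

Exponential tilting does not change the conditional law of `X₁` given `S₁ⁿ = n a`. Hence the
summands may be given the tilted density `f = π^a`, whose mean is `a`, and the conditional density
is `f(x) f^{*(n-1)}(n a - x) / f^{*n}(n a)`. It has to be shown that the quotient of convolution
powers is close to `1` in `L¹(f)`, uniformly in large `a`.

**Uniform shape of the tilted densities.** Beyond some point `g` is convex, so the tilted density
is, up to bounded factors, `exp (t x - g x)` with a concave exponent. A concave exponent decays
linearly at the scale given by the total mass, and the part of the law where `g` is not controlled
is negligible because the maximum of `t x - g x` is at least of the order of `t` times its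
location; this is where the regular variation of `g'` enters, through the inequality `g' (x / 2) ≤
κ g' x` with `κ < 1`. Centred at the mean and suitably rescaled, all tilted densities with large
`t` are therefore bounded by one function `C exp (-|y|)` (`IsLightTail.exists_isExpDominated`).

**Local limit estimates for this class.** Over all centred densities bounded by `C exp (-|y|)` the
Fourier transform has uniform Gaussian decay near `0` and a uniform spectral gap away from `0`
(`exists_fourier_estimates`), and its square is integrable with integral at most `C`. Fourier
inversion gives `f^{*n}(0) ≥ c / √n` (`exists_le_sumDensity_zero`) and a modulus of continuity of
order `1 / n` for `f^{*n}` (`exists_abs_sumDensity_sub_le`). Since `f^{*n}(0)` is the average of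
`f^{*(n-1)}(-z)` under `f`, the `L¹` distance is `O(1 / √n)` (`exists_integral_abs_cond_sub_le`).
-/

noncomputable section

namespace GibbsED

open scoped FourierTransform

/-! ### Convolution powers of a bounded density -/

/-- The convolution of an integrable function and a bounded measurable one is continuous: the
integrable factor is an `L¹` limit of continuous functions with compact support, and the
convolutions converge uniformly. -/
lemma continuous_convolution_of_bounded {f g : ℝ → ℝ} {B : ℝ} (hf : Integrable f)
    (hg : Measurable g) (hB : ∀ x, |g x| ≤ B) :
    Continuous (convolution f g (ContinuousLinearMap.mul ℝ ℝ) volume) := by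
  have hB0 : 0 ≤ B := (abs_nonneg _).trans (hB 0)
  have key : ∀ {u : ℝ → ℝ}, Integrable u → ∀ x, Integrable fun t => u t * g (x - t) := by
    intro u hu x
    refine hu.mul_bdd (c := B) (hg.comp (measurable_const.sub measurable_id)).aestronglyMeasurable
      (Eventually.of_forall fun t => ?_)
    exact hB _
  refine continuous_of_uniform_approx_of_continuous fun U hU => ?_
  obtain ⟨ε, hε, hεU⟩ := Metric.mem_uniformity_dist.1 hU
  obtain ⟨φ, hφs, hφ, hφc, hφi⟩ :=
    hf.exists_hasCompactSupport_integral_sub_le (ε := ε / (2 * (B + 1))) (by positivity)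
  refine ⟨convolution φ g (ContinuousLinearMap.mul ℝ ℝ) volume, ?_, fun x => hεU ?_⟩
  · refine HasCompactSupport.continuous_convolution_left (ContinuousLinearMap.mul ℝ ℝ) hφs hφc ?_
    exact (memLp_top_of_bound hg.aestronglyMeasurable B
      (Eventually.of_forall hB)).locallyIntegrable le_top
  · rw [Real.dist_eq, convolution_def, convolution_def, ← integral_sub]
    · have h1 : ‖∫ t, (f t * g (x - t) - φ t * g (x - t))‖ ≤ ∫ t, ‖f t - φ t‖ * B := by
        refine norm_integral_le_of_norm_le ((hf.sub hφi).norm.mul_const B)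
          (Eventually.of_forall fun t => ?_)
        rw [← sub_mul, norm_mul]
        exact mul_le_mul_of_nonneg_left (hB _) (norm_nonneg _)
      rw [integral_mul_const, Real.norm_eq_abs] at h1
      refine lt_of_le_of_lt (h1.trans (mul_le_mul_of_nonneg_right hφ hB0)) ?_
      rw [div_mul_eq_mul_div, div_lt_iff₀ (by positivity)]
      nlinarith
    · exact key hf x
    · exact key hφi x

lemma fourier_ofReal_convolution {f g : ℝ → ℝ} (hf : Integrable f) (hg : Integrable g) (v : ℝ) :
    𝓕 (fun x => ((convolution f g (ContinuousLinearMap.mul ℝ ℝ) volume x : ℝ) : ℂ)) v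
      = 𝓕 (fun x => (f x : ℂ)) v * 𝓕 (fun x => (g x : ℂ)) v := by
  refine Eq.trans ?_ (Real.fourier_mul_convolution_eq (hf.ofReal (𝕜 := ℂ)) (hg.ofReal (𝕜 := ℂ)) v)
  refine congrFun (congrArg 𝓕 (funext fun x => ?_)) v
  simp only [convolution_def, ContinuousLinearMap.mul_apply']
  rw [← integral_complex_ofReal]
  simp

/-- A measurable probability density bounded by `C`. -/
structure IsBddDensity (C : ℝ) (f : ℝ → ℝ) : Prop where
  measurable : Measurable f
  nonneg : ∀ x, 0 ≤ f x
  le : ∀ x, f x ≤ C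
  integrable : Integrable f
  mass : ∫ x, f x = 1

namespace IsBddDensity

variable {C : ℝ} {f : ℝ → ℝ}

lemma const_nonneg (hf : IsBddDensity C f) : 0 ≤ C := (hf.nonneg 0).trans (hf.le 0)

lemma abs_le (hf : IsBddDensity C f) (x : ℝ) : |f x| ≤ C := by
  rw [abs_of_nonneg (hf.nonneg x)]; exact hf.le x

lemma integrable_mul {g : ℝ → ℝ} {B : ℝ} (hf : IsBddDensity B f) (hg : IsBddDensity C g) (x : ℝ) :
    Integrable fun t => f t * g (x - t) :=
  hf.integrable.mul_bdd (c := C)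
    (hg.measurable.comp (measurable_const.sub measurable_id)).aestronglyMeasurable
    (Eventually.of_forall fun _ => hg.abs_le _)

lemma continuous_convolution {g : ℝ → ℝ} {B : ℝ} (hf : IsBddDensity B f) (hg : IsBddDensity C g) :
    Continuous (convolution f g (ContinuousLinearMap.mul ℝ ℝ) volume) :=
  continuous_convolution_of_bounded hf.integrable hg.measurable hg.abs_le

lemma convolution {g : ℝ → ℝ} {B : ℝ} (hf : IsBddDensity B f) (hg : IsBddDensity C g) :
    IsBddDensity C (convolution f g (ContinuousLinearMap.mul ℝ ℝ) volume) where
  measurable := (hf.continuous_convolution hg).measurable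
  nonneg x := integral_nonneg fun t => mul_nonneg (hf.nonneg _) (hg.nonneg _)
  le x := by
    calc ∫ t, f t * g (x - t) ≤ ∫ t, f t * C :=
          integral_mono (hf.integrable_mul hg x) (hf.integrable.mul_const C)
            fun t => mul_le_mul_of_nonneg_left (hg.le _) (hf.nonneg _)
      _ = C := by rw [integral_mul_const, hf.mass, one_mul]
  integrable := hf.integrable.integrable_convolution _ hg.integrable
  mass := by
    rw [integral_convolution _ hf.integrable hg.integrable, hf.mass, hg.mass]
    simp

lemma sumDensity (hf : IsBddDensity C f) : ∀ n, 1 ≤ n → IsBddDensity C (sumDensity f n)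
  | 1, _ => hf
  | n + 2, _ => hf.convolution (hf.sumDensity (n + 1) (by omega))

lemma continuous_sumDensity (hf : IsBddDensity C f) {n : ℕ} (hn : 2 ≤ n) :
    Continuous (GibbsED.sumDensity f n) := by
  obtain ⟨k, rfl⟩ := Nat.exists_eq_add_of_le' hn
  exact hf.continuous_convolution (hf.sumDensity (k + 1) (by omega))

lemma fourier_sumDensity (hf : IsBddDensity C f) (v : ℝ) : ∀ n, 1 ≤ n →
    𝓕 (fun x => (GibbsED.sumDensity f n x : ℂ)) v = 𝓕 (fun x => (f x : ℂ)) v ^ n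
  | 1, _ => by simp [GibbsED.sumDensity]
  | n + 2, _ => by
    rw [pow_succ', ← fourier_sumDensity hf v (n + 1) (by omega)]
    exact fourier_ofReal_convolution hf.integrable (hf.sumDensity (n + 1) (by omega)).integrable v

lemma norm_fourier_le_one (hf : IsBddDensity C f) (v : ℝ) : ‖𝓕 (fun x => (f x : ℂ)) v‖ ≤ 1 := by
  rw [Real.fourier_eq]
  refine (norm_integral_le_integral_norm _).trans ?_
  simp only [Circle.norm_smul, Complex.norm_real, Real.norm_eq_abs, abs_of_nonneg (hf.nonneg _)]
  exact hf.mass.le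

lemma continuous_fourier (hf : IsBddDensity C f) : Continuous (𝓕 (fun x => (f x : ℂ))) :=
  VectorFourier.fourierIntegral_continuous Real.continuous_fourierChar
    (by exact continuous_inner) hf.integrable.ofReal

lemma reflect (hf : IsBddDensity C f) : IsBddDensity C (fun x => f (-x)) where
  measurable := hf.measurable.comp measurable_neg
  nonneg x := hf.nonneg _
  le x := hf.le _
  integrable := hf.integrable.comp_neg
  mass := by rw [integral_neg_eq_self f]; exact hf.mass

lemma fourier_reflect (v : ℝ) :
    𝓕 (fun x => (f (-x) : ℂ)) v = (starRingEnd ℂ) (𝓕 (fun x => (f x : ℂ)) v) := by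
  rw [Real.fourier_eq', Real.fourier_eq', ← integral_conj, ← integral_neg_eq_self]
  congr 1; ext x
  simp [← Complex.exp_conj, Complex.conj_ofNat]

/-- The Fourier transform of a density bounded by `C` pairs with each Gaussian weight to at most
`C`; this is Parseval's identity for the autocorrelation of `f`. -/
lemma integral_gaussian_mul_norm_sq_fourier_le (hf : IsBddDensity C f) {b : ℝ} (hb : 0 < b) :
    ∫ w : ℝ, Real.exp (-b * w ^ 2) * ‖𝓕 (fun x => (f x : ℂ)) w‖ ^ 2 ≤ C := by
  set k := MeasureTheory.convolution f (fun x => f (-x)) (ContinuousLinearMap.mul ℝ ℝ) volume with hk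
  have hkd : IsBddDensity C k := hf.convolution hf.reflect
  have hFk : ∀ w, 𝓕 (fun x => (k x : ℂ)) w = ((‖𝓕 (fun x => (f x : ℂ)) w‖ ^ 2 : ℝ) : ℂ) := by
    intro w
    rw [hk, fourier_ofReal_convolution hf.integrable hf.reflect.integrable, fourier_reflect,
      Complex.mul_conj, Complex.normSq_eq_norm_sq]
  have hgi : Integrable fun w : ℝ => Complex.exp (-b * w ^ 2 : ℂ) :=
    integrable_cexp_neg_mul_sq (by simpa using hb)
  have h1 := VectorFourier.integral_fourierIntegral_smul_eq_flip (μ := volume) (ν := volume)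
    (L := innerₗ ℝ) Real.continuous_fourierChar continuous_inner hgi (hkd.integrable.ofReal (𝕜 := ℂ))
  have hG : ∀ w : ℝ, 𝓕 (fun w : ℝ => Complex.exp (-b * w ^ 2 : ℂ)) w
      = (((Real.pi / b) ^ (1 / 2 : ℝ) * Real.exp (-(Real.pi ^ 2 / b) * w ^ 2) : ℝ) : ℂ) := by
    intro w
    have := fourier_gaussian_innerProductSpace (V := ℝ) (b := (b : ℂ)) (by simpa using hb) w
    simp only [Real.norm_eq_abs, ← Complex.ofReal_pow, sq_abs] at this
    simp only [← Complex.ofReal_pow]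
    rw [this]
    simp only [Module.finrank_self, Nat.cast_one]
    push_cast
    rw [Complex.ofReal_cpow (by positivity)]
    push_cast
    congr 2
    ring
  have h2 : ∫ w : ℝ, Real.exp (-b * w ^ 2) * ‖𝓕 (fun x => (f x : ℂ)) w‖ ^ 2
      = ∫ w : ℝ, ((Real.pi / b) ^ (1 / 2 : ℝ) * Real.exp (-(Real.pi ^ 2 / b) * w ^ 2)) * k w := by
    have h3 : ∀ w : ℝ, VectorFourier.fourierIntegral Real.fourierChar volume (innerₗ ℝ)
        (fun w : ℝ => Complex.exp (-b * w ^ 2 : ℂ)) w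
          = 𝓕 (fun w : ℝ => Complex.exp (-b * w ^ 2 : ℂ)) w :=
      fun w => rfl
    have h4 : ∀ w : ℝ, VectorFourier.fourierIntegral Real.fourierChar volume (innerₗ ℝ).flip
        (fun w : ℝ => (k w : ℂ)) w = 𝓕 (fun w : ℝ => (k w : ℂ)) w := by
      intro w
      rw [flip_innerₗ]; rfl
    simp only [RCLike.ofReal_eq_complex_ofReal] at h1
    simp only [h3, h4, hFk, hG, smul_eq_mul] at h1
    apply Complex.ofReal_injective
    rw [← integral_complex_ofReal, ← integral_complex_ofReal]
    push_cast at h1 ⊢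
    exact h1.symm
  have h5 : ∫ w : ℝ, (Real.pi / b) ^ (1 / 2 : ℝ) * Real.exp (-(Real.pi ^ 2 / b) * w ^ 2) = 1 := by
    rw [integral_const_mul, integral_gaussian, ← Real.sqrt_eq_rpow,
      ← Real.sqrt_mul (by positivity)]
    rw [show Real.pi / b * (Real.pi / (Real.pi ^ 2 / b)) = 1 by
      have := Real.pi_pos.ne'
      field_simp]
    simp
  have hgi' : Integrable fun w : ℝ =>
      (Real.pi / b) ^ (1 / 2 : ℝ) * Real.exp (-(Real.pi ^ 2 / b) * w ^ 2) :=
    (integrable_exp_neg_mul_sq (by positivity)).const_mul _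
  rw [h2]
  calc _ ≤ ∫ w : ℝ, ((Real.pi / b) ^ (1 / 2 : ℝ) * Real.exp (-(Real.pi ^ 2 / b) * w ^ 2)) * C := by
        refine integral_mono (hgi'.mul_bdd (c := C) hkd.measurable.aestronglyMeasurable
          (Eventually.of_forall hkd.abs_le)) (hgi'.mul_const C) fun w => ?_
        exact mul_le_mul_of_nonneg_left (hkd.le w) (by positivity)
    _ = C := by rw [integral_mul_const, h5, one_mul]

/-- The Plancherel bound `∫ |𝓕 f|² ≤ ∫ f² ≤ C`. -/
lemma integrable_norm_sq_fourier (hf : IsBddDensity C f) :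
    Integrable (fun v => ‖𝓕 (fun x => (f x : ℂ)) v‖ ^ 2) ∧
      ∫ v, ‖𝓕 (fun x => (f x : ℂ)) v‖ ^ 2 ≤ C := by
  set F := 𝓕 (fun x => (f x : ℂ)) with hF
  have hFc : Continuous F := hf.continuous_fourier
  have hlim : ∀ w : ℝ, Tendsto (fun n : ℕ => Real.exp (-(1 / ((n : ℝ) + 1)) * w ^ 2) * ‖F w‖ ^ 2)
      atTop (𝓝 (‖F w‖ ^ 2)) := by
    intro w
    have h1 : Tendsto (fun n : ℕ => Real.exp (-(1 / ((n : ℝ) + 1)) * w ^ 2) * ‖F w‖ ^ 2) atTop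
        (𝓝 (Real.exp (-0 * w ^ 2) * ‖F w‖ ^ 2)) :=
      ((Real.continuous_exp.tendsto _).comp
        ((tendsto_one_div_add_atTop_nhds_zero_nat.neg).mul_const _)).mul_const _
    simpa using h1
  have hbound : ∫⁻ v, ENNReal.ofReal (‖F v‖ ^ 2) ≤ ENNReal.ofReal C := by
    have hmeas : ∀ n : ℕ, Measurable fun v =>
        ENNReal.ofReal (Real.exp (-(1 / ((n : ℝ) + 1)) * v ^ 2) * ‖F v‖ ^ 2) := fun n => by
      have : Continuous fun v => Real.exp (-(1 / ((n : ℝ) + 1)) * v ^ 2) * ‖F v‖ ^ 2 := by fun_prop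
      exact this.measurable.ennreal_ofReal
    calc ∫⁻ v, ENNReal.ofReal (‖F v‖ ^ 2)
        = ∫⁻ v, liminf (fun n : ℕ =>
            ENNReal.ofReal (Real.exp (-(1 / ((n : ℝ) + 1)) * v ^ 2) * ‖F v‖ ^ 2)) atTop := by
          refine lintegral_congr fun v => ?_
          exact ((ENNReal.continuous_ofReal.tendsto _).comp (hlim v)).liminf_eq.symm
      _ ≤ liminf (fun n : ℕ => ∫⁻ v,
            ENNReal.ofReal (Real.exp (-(1 / ((n : ℝ) + 1)) * v ^ 2) * ‖F v‖ ^ 2)) atTop :=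
          lintegral_liminf_le hmeas
      _ ≤ liminf (fun _ : ℕ => ENNReal.ofReal C) atTop := by
          refine liminf_le_liminf (Eventually.of_forall fun n => ?_)
          have hn : (0 : ℝ) < 1 / ((n : ℝ) + 1) := by positivity
          rw [← ofReal_integral_eq_lintegral_ofReal]
          · exact ENNReal.ofReal_le_ofReal (hf.integral_gaussian_mul_norm_sq_fourier_le hn)
          · refine (integrable_exp_neg_mul_sq hn).mul_bdd (c := 1)
              (hFc.norm.pow 2).aestronglyMeasurable (Eventually.of_forall fun v => ?_)
            rw [Real.norm_of_nonneg (by positivity)]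
            exact pow_le_one₀ (norm_nonneg _) (hf.norm_fourier_le_one v)
          · exact Eventually.of_forall fun v => by positivity
      _ = ENNReal.ofReal C := liminf_const _
  have hint : Integrable (fun v => ‖F v‖ ^ 2) := by
    refine ⟨(hFc.norm.pow 2).aestronglyMeasurable, ?_⟩
    rw [hasFiniteIntegral_iff_ofReal (Eventually.of_forall fun v => by positivity)]
    exact hbound.trans_lt ENNReal.ofReal_lt_top
  refine ⟨hint, ?_⟩
  rw [integral_eq_lintegral_of_nonneg_ae (Eventually.of_forall fun v => by positivity)
    hint.aestronglyMeasurable]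
  exact ENNReal.toReal_le_of_le_ofReal hf.const_nonneg hbound

end IsBddDensity

/-! ### Centred densities with a uniform exponential bound -/

lemma integrable_abs_pow_mul_exp_neg_abs (k : ℕ) :
    Integrable fun y : ℝ => |y| ^ k * Real.exp (-|y|) := by
  refine (integrable_inv_one_add_sq.const_mul ((k.factorial + (k + 2).factorial : ℝ))).mono'
    (by fun_prop) (Eventually.of_forall fun y => ?_)
  rw [Real.norm_of_nonneg (by positivity), ← div_eq_mul_inv, le_div_iff₀ (by positivity)]
  have h1 := (div_le_iff₀ (by positivity)).1 (Real.pow_div_factorial_le_exp |y| (abs_nonneg y) k)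
  have h2 := (div_le_iff₀ (by positivity)).1
    (Real.pow_div_factorial_le_exp |y| (abs_nonneg y) (k + 2))
  have h3 : Real.exp (-|y|) * Real.exp |y| = 1 := by rw [← Real.exp_add]; simp
  have h4 : |y| ^ (k + 2) = |y| ^ k * y ^ 2 := by rw [pow_add, sq_abs]
  calc |y| ^ k * Real.exp (-|y|) * (1 + y ^ 2)
      = Real.exp (-|y|) * (|y| ^ k + |y| ^ (k + 2)) := by rw [h4]; ring
    _ ≤ Real.exp (-|y|) * (Real.exp |y| * k.factorial + Real.exp |y| * (k + 2).factorial) := by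
        gcongr
    _ = (Real.exp (-|y|) * Real.exp |y|) * (k.factorial + (k + 2).factorial : ℝ) := by ring
    _ = _ := by rw [h3, one_mul]

/-- The `k`-th absolute moment of the weight `exp (-|y|)`. -/
def expMoment (k : ℕ) : ℝ := ∫ y : ℝ, |y| ^ k * Real.exp (-|y|)

lemma expMoment_nonneg (k : ℕ) : 0 ≤ expMoment k := integral_nonneg fun _ => by positivity

/-- A centred probability density which is at most `C exp (-|y|)`. -/
structure IsExpDominated (C : ℝ) (f : ℝ → ℝ) : Prop where
  measurable : Measurable f
  nonneg : ∀ y, 0 ≤ f y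
  le : ∀ y, f y ≤ C * Real.exp (-|y|)
  mass : ∫ y, f y = 1
  mean : ∫ y, y * f y = 0

namespace IsExpDominated

variable {C : ℝ} {f : ℝ → ℝ}

lemma const_nonneg (hf : IsExpDominated C f) : 0 ≤ C := by
  have := (hf.nonneg 0).trans (hf.le 0)
  simpa using this

lemma le_const (hf : IsExpDominated C f) (y : ℝ) : f y ≤ C :=
  (hf.le y).trans (mul_le_of_le_one_right hf.const_nonneg (by simp))

lemma integrable_abs_pow (hf : IsExpDominated C f) (k : ℕ) :
    Integrable fun y => |y| ^ k * f y := by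
  have := hf.measurable
  refine ((integrable_abs_pow_mul_exp_neg_abs k).const_mul C).mono' (by fun_prop)
    (Eventually.of_forall fun y => ?_)
  rw [Real.norm_of_nonneg (mul_nonneg (by positivity) (hf.nonneg y))]
  calc |y| ^ k * f y ≤ |y| ^ k * (C * Real.exp (-|y|)) := by gcongr; exact hf.le y
    _ = _ := by ring

lemma integral_abs_pow_le (hf : IsExpDominated C f) (k : ℕ) :
    ∫ y, |y| ^ k * f y ≤ C * expMoment k := by
  rw [expMoment, ← integral_const_mul]
  refine integral_mono (hf.integrable_abs_pow k)
    ((integrable_abs_pow_mul_exp_neg_abs k).const_mul C) fun y => ?_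
  calc |y| ^ k * f y ≤ |y| ^ k * (C * Real.exp (-|y|)) := by gcongr; exact hf.le y
    _ = _ := by ring

lemma isBddDensity (hf : IsExpDominated C f) : IsBddDensity C f where
  measurable := hf.measurable
  nonneg := hf.nonneg
  le := hf.le_const
  integrable := by simpa using hf.integrable_abs_pow 0
  mass := hf.mass

lemma integrable_sq (hf : IsExpDominated C f) : Integrable fun y => y ^ 2 * f y := by
  simpa using hf.integrable_abs_pow 2

lemma integrable_id_mul (hf : IsExpDominated C f) : Integrable fun y => y * f y := by
  have := hf.measurable
  refine (hf.integrable_abs_pow 1).mono' (by fun_prop) (Eventually.of_forall fun y => ?_)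
  rw [norm_mul, Real.norm_eq_abs, Real.norm_of_nonneg (hf.nonneg y), pow_one]

lemma const_pos (hf : IsExpDominated C f) : 0 < C := by
  refine hf.const_nonneg.lt_of_ne fun h => ?_
  have h0 : ∀ y, f y = 0 := fun y => le_antisymm (by simpa [← h] using hf.le y) (hf.nonneg y)
  have := hf.mass
  simp [h0] at this

/-- A density bounded by `C` has variance at least `1 / (32 C²)`, as at least half of its mass lies
outside `[-1/(4C), 1/(4C)]`. -/
lemma le_integral_sq (hf : IsExpDominated C f) : 1 / (32 * C ^ 2) ≤ ∫ y, y ^ 2 * f y := by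
  have hC := hf.const_pos
  set r : ℝ := 1 / (4 * C) with hr
  have hr0 : 0 < r := by positivity
  have hi : Integrable (indicator (Icc (-r) r) fun _ => r ^ 2 * C) :=
    (integrable_indicator_iff measurableSet_Icc).2
      (integrableOn_const (by simp [Real.volume_Icc]))
  have h1 : ∫ y, (r ^ 2 * f y - indicator (Icc (-r) r) (fun _ => r ^ 2 * C) y)
      ≤ ∫ y, y ^ 2 * f y := by
    refine integral_mono ((hf.isBddDensity.integrable.const_mul _).sub hi) hf.integrable_sq
      fun y => ?_
    by_cases hy : y ∈ Icc (-r) r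
    · simp only [indicator_of_mem hy]
      have := mul_le_mul_of_nonneg_left (hf.le_const y) (sq_nonneg r)
      nlinarith [mul_nonneg (sq_nonneg y) (hf.nonneg y)]
    · simp only [indicator_of_notMem hy, sub_zero]
      refine mul_le_mul_of_nonneg_right (sq_le_sq.2 ?_) (hf.nonneg y)
      rw [abs_of_pos hr0]
      by_contra hcon
      exact hy (abs_le.1 (not_le.1 hcon).le)
  rw [integral_sub (hf.isBddDensity.integrable.const_mul _) hi, integral_const_mul, hf.mass,
    integral_indicator measurableSet_Icc, setIntegral_const, smul_eq_mul, Real.volume_real_Icc,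
    max_eq_left (by linarith)] at h1
  refine le_trans (le_of_eq ?_) h1
  rw [hr]
  field_simp
  norm_num

end IsExpDominated

lemma norm_exp_I_sub_taylor_two_le (x : ℝ) :
    ‖Complex.exp (x * Complex.I) - (1 + x * Complex.I - x ^ 2 / 2)‖ ≤ 4 * |x| ^ 3 := by
  rcases le_or_gt |x| 1 with h | h
  · have h1 : ‖(x * Complex.I : ℂ)‖ ≤ 1 := by simpa using h
    have h2 := Complex.exp_bound h1 (n := 3) (by norm_num)
    have h3 : ∑ m ∈ Finset.range 3, (x * Complex.I : ℂ) ^ m / m.factorial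
        = 1 + x * Complex.I - x ^ 2 / 2 := by
      simp only [Finset.sum_range_succ, Finset.sum_range_zero, mul_pow, Complex.I_sq]
      norm_num [Nat.factorial]
      ring
    rw [h3] at h2
    refine h2.trans ?_
    have h4 : ‖(x * Complex.I : ℂ)‖ = |x| := by simp
    rw [h4]
    norm_num [Nat.factorial]
    nlinarith [pow_nonneg (abs_nonneg x) 3]
  · have h1 : ‖(1 + x * Complex.I - x ^ 2 / 2 : ℂ)‖ ≤ 1 + |x| + |x| ^ 2 / 2 := by
      refine (norm_sub_le _ _).trans (add_le_add ((norm_add_le _ _).trans ?_) ?_) <;> simp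
    refine (norm_sub_le _ _).trans ?_
    rw [Complex.norm_exp_ofReal_mul_I]
    have h2 : |x| ≤ |x| ^ 3 := le_self_pow₀ h.le (by norm_num)
    have h3 : |x| ^ 2 ≤ |x| ^ 3 := pow_le_pow_right₀ h.le (by norm_num)
    have h4 : 1 ≤ |x| ^ 3 := one_le_pow₀ h.le
    linarith

lemma fourier_ofReal_eq (f : ℝ → ℝ) (v : ℝ) :
    𝓕 (fun x => (f x : ℂ)) v
      = ∫ y : ℝ, Complex.exp ((-(2 * Real.pi * v * y) : ℝ) * Complex.I) * (f y : ℂ) := by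
  rw [Real.fourier_eq']
  refine integral_congr_ae (Eventually.of_forall fun y => ?_)
  simp only [smul_eq_mul]
  congr 2
  simp
  ring

/-- Second order Taylor expansion of the Fourier transform of a centred density. -/
lemma IsExpDominated.norm_fourier_sub_le {C : ℝ} {f : ℝ → ℝ} (hf : IsExpDominated C f) (v : ℝ) :
    ‖𝓕 (fun x => (f x : ℂ)) v - ((1 - 2 * Real.pi ^ 2 * (∫ y, y ^ 2 * f y) * v ^ 2 : ℝ) : ℂ)‖
      ≤ 4 * (2 * Real.pi) ^ 3 * (C * expMoment 3) * |v| ^ 3 := by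
  have hb := hf.isBddDensity
  have hi1 : Integrable fun y : ℝ =>
      Complex.exp ((-(2 * Real.pi * v * y) : ℝ) * Complex.I) * (f y : ℂ) := by
    refine hb.integrable.ofReal.bdd_mul (c := 1) (by fun_prop) (Eventually.of_forall fun y => ?_)
    rw [Complex.norm_exp_ofReal_mul_I]
  have h0 : Integrable fun y : ℝ => (f y : ℂ) := hb.integrable.ofReal
  have h1 : Integrable fun y : ℝ => ((y * f y : ℝ) : ℂ) := hf.integrable_id_mul.ofReal
  have h2 : Integrable fun y : ℝ => ((y ^ 2 * f y : ℝ) : ℂ) := hf.integrable_sq.ofReal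
  have hi2 : Integrable fun y : ℝ => (f y : ℂ)
      + (-(2 * Real.pi * v) * Complex.I) * ((y * f y : ℝ) : ℂ)
      - 2 * Real.pi ^ 2 * v ^ 2 * ((y ^ 2 * f y : ℝ) : ℂ) :=
    (h0.add (h1.const_mul _)).sub (h2.const_mul _)
  have hI2 : ∫ y : ℝ, ((f y : ℂ) + (-(2 * Real.pi * v) * Complex.I) * ((y * f y : ℝ) : ℂ)
      - 2 * Real.pi ^ 2 * v ^ 2 * ((y ^ 2 * f y : ℝ) : ℂ))
      = ((1 - 2 * Real.pi ^ 2 * (∫ y, y ^ 2 * f y) * v ^ 2 : ℝ) : ℂ) := by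
    rw [integral_sub (by exact h0.add (h1.const_mul _)) (h2.const_mul _),
      integral_add h0 (h1.const_mul _),
      integral_const_mul, integral_const_mul, integral_complex_ofReal, integral_complex_ofReal,
      integral_complex_ofReal, hf.mass, hf.mean]
    push_cast
    ring
  rw [fourier_ofReal_eq, ← hI2, ← integral_sub hi1 hi2]
  have h3 : ∫ y, 4 * (2 * Real.pi) ^ 3 * |v| ^ 3 * (|y| ^ 3 * f y)
      ≤ 4 * (2 * Real.pi) ^ 3 * (C * expMoment 3) * |v| ^ 3 := by
    rw [integral_const_mul]
    have := mul_le_mul_of_nonneg_left (hf.integral_abs_pow_le 3)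
      (show 0 ≤ 4 * (2 * Real.pi) ^ 3 * |v| ^ 3 by positivity)
    linarith
  refine (norm_integral_le_of_norm_le ((hf.integrable_abs_pow 3).const_mul _)
    (Eventually.of_forall fun y => ?_)).trans h3
  have h4 := norm_exp_I_sub_taylor_two_le (-(2 * Real.pi * v * y))
  have h5 : Complex.exp ((-(2 * Real.pi * v * y) : ℝ) * Complex.I) * (f y : ℂ)
      - ((f y : ℂ) + (-(2 * Real.pi * v) * Complex.I) * ((y * f y : ℝ) : ℂ)
      - 2 * Real.pi ^ 2 * v ^ 2 * ((y ^ 2 * f y : ℝ) : ℂ))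
      = (Complex.exp ((-(2 * Real.pi * v * y) : ℝ) * Complex.I)
        - (1 + (-(2 * Real.pi * v * y) : ℝ) * Complex.I
          - ((-(2 * Real.pi * v * y) : ℝ) : ℂ) ^ 2 / 2)) * (f y : ℂ) := by
    push_cast
    ring
  rw [h5, norm_mul, Complex.norm_real, Real.norm_of_nonneg (hf.nonneg y)]
  refine (mul_le_mul_of_nonneg_right h4 (hf.nonneg y)).trans (le_of_eq ?_)
  rw [abs_neg, abs_mul, abs_mul, abs_of_pos Real.two_pi_pos]
  ring

/-! ### Frequencies bounded away from zero -/

/-- The `N`-th power of `(1 + cos) / 2`, a bump concentrated at the zeros of `1 - cos`. -/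
def cosBump (N : ℕ) (θ : ℝ) : ℝ := ((1 + Real.cos θ) / 2) ^ N

lemma continuous_cosBump (N : ℕ) : Continuous (cosBump N) := by unfold cosBump; fun_prop

lemma cosBump_nonneg (N : ℕ) (θ : ℝ) : 0 ≤ cosBump N θ :=
  pow_nonneg (by linarith [Real.neg_one_le_cos θ]) _

lemma cosBump_le_one (N : ℕ) (θ : ℝ) : cosBump N θ ≤ 1 :=
  pow_le_one₀ (by linarith [Real.neg_one_le_cos θ]) (by linarith [Real.cos_le_one θ])

lemma cosBump_periodic (N : ℕ) : Function.Periodic (cosBump N) (2 * Real.pi) := fun θ => by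
  simp [cosBump]

lemma one_sub_cosBump_le (N : ℕ) (θ : ℝ) : 1 - cosBump N θ ≤ N / 2 * (1 - Real.cos θ) := by
  have := one_add_mul_le_pow (a := (Real.cos θ - 1) / 2)
    (by linarith [Real.neg_one_le_cos θ]) N
  rw [cosBump, show (1 + Real.cos θ) / 2 = 1 + (Real.cos θ - 1) / 2 by ring]
  nlinarith

lemma tendsto_integral_cosBump :
    Tendsto (fun N => ∫ θ in (0 : ℝ)..2 * Real.pi, cosBump N θ) atTop (𝓝 0) := by
  have h := intervalIntegral.tendsto_integral_filter_of_dominated_convergence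
    (μ := volume) (a := 0) (b := 2 * Real.pi) (F := fun N θ => cosBump N θ) (f := fun _ => (0 : ℝ))
    (l := atTop) (fun _ => 1)
    (Eventually.of_forall fun N => (continuous_cosBump N).aestronglyMeasurable)
    (Eventually.of_forall fun N => Eventually.of_forall fun θ _ => by
      rw [Real.norm_of_nonneg (cosBump_nonneg N θ)]; exact cosBump_le_one N θ)
    intervalIntegrable_const ?_
  · simpa using h
  · have h0 : ∀ᵐ θ : ℝ, θ ≠ 2 * Real.pi := by
      simp [ae_iff, measure_singleton]
    filter_upwards [h0] with θ hθ hmem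
    rw [uIoc_of_le Real.two_pi_pos.le] at hmem
    refine tendsto_pow_atTop_nhds_zero_of_lt_one (by linarith [Real.neg_one_le_cos θ]) ?_
    have : Real.cos θ ≠ 1 := fun h => by
      have hlt : θ < 2 * Real.pi := lt_of_le_of_ne hmem.2 hθ
      have := (Real.cos_eq_one_iff_of_lt_of_lt (by linarith [hmem.1, Real.pi_pos]) hlt).1 h
      exact hmem.1.ne' this
    linarith [lt_of_le_of_ne (Real.cos_le_one θ) this]

/-- The mean of the bump along an affine phase: the interval `[-R, R]` is covered by `⌈2 v R⌉`
periods of `y ↦ cosBump N (2 π v y + θ)`. -/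
lemma integral_cosBump_comp_le (N : ℕ) {v R : ℝ} (hv : 0 < v) (hR : 0 ≤ R) (θ : ℝ) :
    ∫ y in (-R)..R, cosBump N (2 * Real.pi * v * y + θ)
      ≤ (R + 1 / v) * ∫ θ in (0 : ℝ)..2 * Real.pi, cosBump N θ := by
  set J := ∫ θ in (0 : ℝ)..2 * Real.pi, cosBump N θ with hJ
  have hJ0 : 0 ≤ J := intervalIntegral.integral_nonneg Real.two_pi_pos.le
    fun θ _ => cosBump_nonneg N θ
  have hpi := Real.pi_pos
  have hii : ∀ a b, IntervalIntegrable (cosBump N) volume a b :=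
    fun a b => (continuous_cosBump N).intervalIntegrable a b
  rw [intervalIntegral.integral_comp_mul_add _ (by positivity), smul_eq_mul]
  set A := 2 * Real.pi * v * -R + θ with hA
  set n : ℕ := ⌈2 * v * R⌉₊ with hn
  have hn1 : 2 * v * R ≤ n := Nat.le_ceil _
  have hn2 : (n : ℝ) < 2 * v * R + 1 := Nat.ceil_lt_add_one (by positivity)
  have hp := (cosBump_periodic N).intervalIntegral_add_zsmul_eq n A hii
  rw [(cosBump_periodic N).intervalIntegral_add_eq A 0, zero_add, ← hJ] at hp
  have hmono : ∫ x in A..(2 * Real.pi * v * R + θ), cosBump N x ≤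
      ∫ x in A..(A + (n : ℤ) • (2 * Real.pi)), cosBump N x := by
    refine intervalIntegral.integral_mono_interval le_rfl ?_ ?_
      (Eventually.of_forall fun x => cosBump_nonneg N x) (hii _ _)
    · rw [hA]; nlinarith [mul_nonneg (mul_nonneg hpi.le hv.le) hR]
    · simp only [zsmul_eq_mul, Int.cast_natCast]
      rw [hA]; nlinarith
  rw [hp, zsmul_eq_mul, Int.cast_natCast] at hmono
  have h1 : (n : ℝ) * J ≤ (2 * v * R + 1) * J := mul_le_mul_of_nonneg_right hn2.le hJ0
  calc (2 * Real.pi * v)⁻¹ * ∫ x in A..(2 * Real.pi * v * R + θ), cosBump N x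
      ≤ (2 * Real.pi * v)⁻¹ * ((2 * v * R + 1) * J) := by
        gcongr; exact hmono.trans h1
    _ = (R / Real.pi + 1 / (2 * Real.pi * v)) * J := by field_simp
    _ ≤ (R + 1 / v) * J := by
        refine mul_le_mul_of_nonneg_right (add_le_add ?_ ?_) hJ0
        · exact div_le_self hR (by linarith [Real.pi_gt_three])
        · refine one_div_le_one_div_of_le hv ?_
          nlinarith [Real.pi_gt_three]

lemma exists_norm_fourier_eq_integral_cos {C : ℝ} {f : ℝ → ℝ} (hf : IsBddDensity C f) (v : ℝ) :
    ∃ θ, ‖𝓕 (fun x => (f x : ℂ)) v‖ = ∫ y, Real.cos (2 * Real.pi * |v| * y + θ) * f y := by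
  set z := 𝓕 (fun x => (f x : ℂ)) v with hz
  have h1 : Complex.exp (((-z.arg : ℝ) : ℂ) * Complex.I) * z = (‖z‖ : ℂ) := by
    nth_rw 2 [← Complex.norm_mul_exp_arg_mul_I z]
    rw [mul_left_comm, ← Complex.exp_add]
    simp
  have h2 : ‖z‖ = ∫ y, Real.cos (-(2 * Real.pi * v * y) - z.arg) * f y := by
    have hi : Integrable fun y : ℝ => Complex.exp (((-z.arg : ℝ) : ℂ) * Complex.I) *
        (Complex.exp ((-(2 * Real.pi * v * y) : ℝ) * Complex.I) * (f y : ℂ)) := by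
      refine Integrable.const_mul ?_ _
      refine hf.integrable.ofReal.bdd_mul (c := 1) (by fun_prop) (Eventually.of_forall fun y => ?_)
      rw [Complex.norm_exp_ofReal_mul_I]
    have h3 : ‖z‖ = (Complex.exp (((-z.arg : ℝ) : ℂ) * Complex.I) * z).re := by
      rw [h1, Complex.ofReal_re]
    have h4 : z = ∫ y : ℝ, Complex.exp ((-(2 * Real.pi * v * y) : ℝ) * Complex.I) * (f y : ℂ) :=
      fourier_ofReal_eq f v
    rw [h3]
    nth_rw 2 [h4]
    rw [← integral_const_mul]
    refine (integral_re hi).symm.trans (integral_congr_ae (Eventually.of_forall fun y => ?_))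
    simp only [RCLike.re_to_complex]
    rw [← mul_assoc, ← Complex.exp_add, Complex.re_mul_ofReal, ← add_mul, ← Complex.ofReal_add,
      Complex.exp_ofReal_mul_I_re]
    congr 2
    ring
  rcases le_total 0 v with hv | hv
  · refine ⟨z.arg, h2.trans (integral_congr_ae (Eventually.of_forall fun y => ?_))⟩
    simp only [abs_of_nonneg hv]
    rw [← Real.cos_neg]
    congr 2; ring
  · refine ⟨-z.arg, h2.trans (integral_congr_ae (Eventually.of_forall fun y => ?_))⟩
    simp only [abs_of_nonpos hv]
    congr 2; ring

/-- Away from the origin the Fourier transforms of all densities bounded by `C exp (-|y|)` are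
bounded by a common constant less than one. If `‖𝓕 f v‖` were close to one, then `f` would be
concentrated near the zeros of `y ↦ 1 - cos (2 π v y + θ)` for some phase `θ`; these
neighbourhoods are too small to carry the mass of a bounded density. -/
lemma exists_norm_fourier_le_of_le_abs {C v₁ : ℝ} (hC : 0 < C) (hv₁ : 0 < v₁) :
    ∃ δ > 0, ∀ f, IsExpDominated C f → ∀ v, v₁ ≤ |v| →
      ‖𝓕 (fun x => (f x : ℂ)) v‖ ≤ Real.exp (-δ) := by
  -- by Markov's inequality at most a quarter of the mass lies outside `[-R, R]`, and `N` is chosen so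
  -- that the bump picks up at most a quarter of the mass inside
  set R : ℝ := 4 * (C * expMoment 1) + 1 with hR
  have hR0 : 0 < R := by have := expMoment_nonneg 1; positivity
  have hlim := (tendsto_integral_cosBump.const_mul (C * (R + 1 / v₁)))
  rw [mul_zero] at hlim
  obtain ⟨N, hN1, hN⟩ := ((eventually_ge_atTop 1).and
    (hlim.eventually_le_const (show (0 : ℝ) < 1 / 4 by norm_num))).exists
  have hNpos : (0 : ℝ) < N := by exact_mod_cast hN1
  refine ⟨1 / N, by positivity, fun f hf v hv => ?_⟩
  have hb := hf.isBddDensity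
  obtain ⟨θ, hθ⟩ := exists_norm_fourier_eq_integral_cos hb v
  set u := |v| with hu
  have hu0 : 0 < u := hv₁.trans_le hv
  have hGc : Continuous fun y => cosBump N (2 * Real.pi * u * y + θ) :=
    (continuous_cosBump N).comp (by fun_prop)
  have hiG : Integrable fun y => cosBump N (2 * Real.pi * u * y + θ) * f y := by
    refine hb.integrable.bdd_mul (c := 1) hGc.aestronglyMeasurable (Eventually.of_forall fun y => ?_)
    rw [Real.norm_of_nonneg (cosBump_nonneg _ _)]; exact cosBump_le_one _ _
  have hic : Integrable fun y => Real.cos (2 * Real.pi * u * y + θ) * f y := by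
    refine hb.integrable.bdd_mul (c := 1) (by fun_prop) (Eventually.of_forall fun y => ?_)
    exact Real.abs_cos_le_one _
  have hind : Integrable (indicator (Ioc (-R) R) fun y =>
      C * cosBump N (2 * Real.pi * u * y + θ)) :=
    (integrable_indicator_iff measurableSet_Ioc).2
      (((continuous_const.mul hGc).integrableOn_Icc).mono_set Ioc_subset_Icc_self)
  have hbump : ∫ y, cosBump N (2 * Real.pi * u * y + θ) * f y ≤ 1 / 2 := by
    have h1 : ∫ y, cosBump N (2 * Real.pi * u * y + θ) * f y ≤
        ∫ y, (indicator (Ioc (-R) R) (fun y => C * cosBump N (2 * Real.pi * u * y + θ)) y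
          + R⁻¹ * (|y| ^ 1 * f y)) := by
      refine integral_mono hiG (hind.add ((hf.integrable_abs_pow 1).const_mul _)) fun y => ?_
      by_cases hy : y ∈ Ioc (-R) R
      · simp only [indicator_of_mem hy]
        have h2 : 0 ≤ R⁻¹ * (|y| ^ 1 * f y) :=
          mul_nonneg (by positivity) (mul_nonneg (by positivity) (hf.nonneg y))
        have h3 := mul_le_mul_of_nonneg_left (hf.le_const y)
          (cosBump_nonneg N (2 * Real.pi * u * y + θ))
        linarith
      · simp only [indicator_of_notMem hy, zero_add, pow_one]
        rw [← mul_assoc]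
        refine mul_le_mul_of_nonneg_right ((cosBump_le_one _ _).trans ?_) (hf.nonneg y)
        rw [inv_mul_eq_div, le_div_iff₀ hR0, one_mul]
        by_contra hcon
        have := abs_lt.1 (not_le.1 hcon)
        exact hy ⟨this.1, this.2.le⟩
    rw [integral_add hind ((hf.integrable_abs_pow 1).const_mul _),
      integral_indicator measurableSet_Ioc, integral_const_mul, integral_const_mul,
      ← intervalIntegral.integral_of_le (by linarith)] at h1
    have h2 := integral_cosBump_comp_le N hu0 hR0.le θ
    have hJ0 : 0 ≤ ∫ θ in (0 : ℝ)..2 * Real.pi, cosBump N θ :=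
      intervalIntegral.integral_nonneg Real.two_pi_pos.le fun θ _ => cosBump_nonneg N θ
    have h3 : C * ∫ y in (-R)..R, cosBump N (2 * Real.pi * u * y + θ) ≤ 1 / 4 := by
      refine le_trans ?_ hN
      rw [mul_assoc C]
      refine mul_le_mul_of_nonneg_left (h2.trans (mul_le_mul_of_nonneg_right ?_ hJ0)) hC.le
      exact add_le_add_right (one_div_le_one_div_of_le hv₁ hv) _
    have h4 : R⁻¹ * ∫ y, |y| ^ 1 * f y ≤ 1 / 4 := by
      rw [inv_mul_le_iff₀ hR0]
      have := hf.integral_abs_pow_le 1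
      linarith
    linarith
  have hfin : 1 - ∫ y, cosBump N (2 * Real.pi * u * y + θ) * f y
      ≤ N / 2 * (1 - ∫ y, Real.cos (2 * Real.pi * u * y + θ) * f y) := by
    rw [← hf.mass, ← integral_sub hb.integrable hiG, ← integral_sub hb.integrable hic,
      ← integral_const_mul]
    refine integral_mono (hb.integrable.sub hiG) ((hb.integrable.sub hic).const_mul _) fun y => ?_
    have := mul_le_mul_of_nonneg_right (one_sub_cosBump_le N (2 * Real.pi * u * y + θ))
      (hf.nonneg y)
    simp only
    linarith
  rw [hθ]
  have h5 : 1 / (N : ℝ) ≤ 1 - ∫ y, Real.cos (2 * Real.pi * u * y + θ) * f y := by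
    rw [div_le_iff₀ hNpos]
    linarith
  linarith [Real.add_one_le_exp (-(1 / (N : ℝ)))]

/-- Uniform estimates for the Fourier transforms of centred densities bounded by `C exp (-|y|)`:
Gaussian decay and a quadratic approximation near the origin, and a spectral gap away from it. -/
lemma exists_fourier_estimates {C : ℝ} (hC : 0 < C) :
    ∃ α > 0, ∃ v₁ > 0, ∃ δ > 0, ∃ B ≥ 0, ∃ b > 0, ∀ f, IsExpDominated C f → ∃ s ≤ b,
      (∀ v, |v| ≤ v₁ → ‖𝓕 (fun x => (f x : ℂ)) v‖ ≤ Real.exp (-(α * v ^ 2)) ∧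
        0 ≤ 1 - s * v ^ 2 ∧ 1 - s * v ^ 2 ≤ Real.exp (-(α * v ^ 2)) ∧
        ‖𝓕 (fun x => (f x : ℂ)) v - ((1 - s * v ^ 2 : ℝ) : ℂ)‖ ≤ B * |v| ^ 3) ∧
      ∀ v, v₁ ≤ |v| → ‖𝓕 (fun x => (f x : ℂ)) v‖ ≤ Real.exp (-δ) := by
  set α : ℝ := Real.pi ^ 2 * (1 / (32 * C ^ 2)) with hα
  set B : ℝ := 4 * (2 * Real.pi) ^ 3 * (C * expMoment 3) with hB
  set b : ℝ := 2 * Real.pi ^ 2 * (C * expMoment 2) + 1 with hb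
  have hB0 : 0 ≤ B := by have := expMoment_nonneg 3; positivity
  have hb0 : 0 < b := by have := expMoment_nonneg 2; positivity
  have hα0 : 0 < α := by positivity
  -- for `|v| ≤ v₁` the quadratic `1 - s v²` is nonnegative and the cubic error is at most `α v²`,
  -- half of what the quadratic term gains
  set v₁ : ℝ := min (1 / √b) (α / (B + 1)) with hv
  have hv0 : 0 < v₁ := by positivity
  obtain ⟨δ, hδ, hδf⟩ := exists_norm_fourier_le_of_le_abs hC hv0
  refine ⟨α, hα0, v₁, hv0, δ, hδ, B, hB0, b, hb0, fun f hf => ?_⟩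
  have hs1 := hf.le_integral_sq
  have hs2 : ∫ y, y ^ 2 * f y ≤ C * expMoment 2 := by simpa using hf.integral_abs_pow_le 2
  have hT := hf.norm_fourier_sub_le
  set s := 2 * Real.pi ^ 2 * ∫ y, y ^ 2 * f y with hs
  have hsb : s ≤ b := by
    rw [hs, hb]
    have := mul_le_mul_of_nonneg_left hs2 (show 0 ≤ 2 * Real.pi ^ 2 by positivity)
    linarith
  have hsα : 2 * α ≤ s := by
    rw [hs, hα]
    have := mul_le_mul_of_nonneg_left hs1 (show 0 ≤ 2 * Real.pi ^ 2 by positivity)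
    linarith
  refine ⟨s, hsb, fun v hvv => ?_, fun v hvv => hδf f hf v hvv⟩
  have h1 : v ^ 2 ≤ 1 / b := by
    have : |v| ≤ 1 / √b := hvv.trans (min_le_left _ _)
    have := pow_le_pow_left₀ (abs_nonneg v) this 2
    rwa [sq_abs, div_pow, one_pow, Real.sq_sqrt hb0.le] at this
  have h2 : B * |v| ≤ α := by
    have h3 : |v| ≤ α / (B + 1) := hvv.trans (min_le_right _ _)
    rw [le_div_iff₀ (by positivity)] at h3
    nlinarith [abs_nonneg v]
  have h3 : B * |v| ^ 3 ≤ α * v ^ 2 := by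
    have := mul_le_mul_of_nonneg_right h2 (sq_nonneg v)
    calc B * |v| ^ 3 = B * |v| * v ^ 2 := by rw [← sq_abs v]; ring
      _ ≤ _ := this
  have h4 : 0 ≤ 1 - s * v ^ 2 := by
    have h5 := mul_le_mul_of_nonneg_right hsb (sq_nonneg v)
    rw [le_div_iff₀ hb0] at h1
    linarith
  have h6 : 2 * α * v ^ 2 ≤ s * v ^ 2 := mul_le_mul_of_nonneg_right hsα (sq_nonneg v)
  have h7 := Real.add_one_le_exp (-(α * v ^ 2))
  have h8 := hT v
  have h9 : 0 ≤ α * v ^ 2 := by positivity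
  refine ⟨?_, h4, by linarith, h8⟩
  have h10 := norm_le_norm_add_norm_sub ((1 - s * v ^ 2 : ℝ) : ℂ) (𝓕 (fun x => (f x : ℂ)) v)
  rw [Complex.norm_real, Real.norm_of_nonneg h4, norm_sub_rev] at h10
  linarith

/-! ### Local limit estimates, uniform over the class of densities -/

namespace IsBddDensity

variable {C : ℝ} {f : ℝ → ℝ}

lemma norm_fourier_pow_le (hf : IsBddDensity C f) {n : ℕ} (hn : 2 ≤ n) (v : ℝ) :
    ‖𝓕 (fun x => (f x : ℂ)) v ^ n‖ ≤ ‖𝓕 (fun x => (f x : ℂ)) v‖ ^ 2 := by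
  rw [norm_pow]
  exact pow_le_pow_of_le_one (norm_nonneg _) (hf.norm_fourier_le_one v) hn

lemma integrable_fourier_pow (hf : IsBddDensity C f) {n : ℕ} (hn : 2 ≤ n) :
    Integrable fun v => 𝓕 (fun x => (f x : ℂ)) v ^ n :=
  hf.integrable_norm_sq_fourier.1.mono' (hf.continuous_fourier.pow n).aestronglyMeasurable
    (Eventually.of_forall fun v => hf.norm_fourier_pow_le hn v)

/-- Fourier inversion for the density of the sum of `n ≥ 2` variables. -/
lemma sumDensity_eq_integral (hf : IsBddDensity C f) {n : ℕ} (hn : 2 ≤ n) (x : ℝ) :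
    (GibbsED.sumDensity f n x : ℂ)
      = ∫ v : ℝ, Complex.exp ((2 * Real.pi * v * x : ℝ) * Complex.I) *
          𝓕 (fun x => (f x : ℂ)) v ^ n := by
  have hS := hf.sumDensity n (by omega)
  have hF : 𝓕 (fun x => (GibbsED.sumDensity f n x : ℂ))
      = fun v => 𝓕 (fun x => (f x : ℂ)) v ^ n :=
    funext fun v => hf.fourier_sumDensity v n (by omega)
  have hinv := Continuous.fourierInv_fourier_eq (f := fun x => (GibbsED.sumDensity f n x : ℂ))
    (Complex.continuous_ofReal.comp (hf.continuous_sumDensity hn)) hS.integrable.ofReal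
    (by rw [hF]; exact hf.integrable_fourier_pow hn)
  have := congrFun hinv x
  rw [hF, Real.fourierInv_eq'] at this
  rw [← this]
  refine integral_congr_ae (Eventually.of_forall fun v => ?_)
  simp only [smul_eq_mul]
  congr 2
  simp
  ring

end IsBddDensity

lemma integrable_abs_pow_mul_exp_neg_mul_sq {α : ℝ} (hα : 0 < α) (k : ℕ) :
    Integrable fun v : ℝ => |v| ^ k * Real.exp (-(α * v ^ 2)) := by
  have h := (integrable_rpow_mul_exp_neg_mul_sq hα (s := k)
    (by have : (0 : ℝ) ≤ k := k.cast_nonneg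
        linarith)).norm
  refine h.congr (Eventually.of_forall fun v => ?_)
  simp [Real.rpow_natCast, neg_mul]

lemma integral_abs_pow_mul_exp_neg_mul_sq {α m : ℝ} (hm : 0 < m) (k : ℕ) :
    ∫ v : ℝ, |v| ^ k * Real.exp (-(α * m * v ^ 2))
      = (∫ v : ℝ, |v| ^ k * Real.exp (-(α * v ^ 2))) / √m ^ (k + 1) := by
  have hs : 0 < √m := Real.sqrt_pos.2 hm
  have h := Measure.integral_comp_mul_left (fun v : ℝ => |v| ^ k * Real.exp (-(α * v ^ 2))) (√m)
  have h1 : ∀ v : ℝ, |√m * v| ^ k * Real.exp (-(α * (√m * v) ^ 2))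
      = √m ^ k * (|v| ^ k * Real.exp (-(α * m * v ^ 2))) := by
    intro v
    rw [abs_mul, abs_of_pos hs, mul_pow, mul_pow, Real.sq_sqrt hm.le]
    ring_nf
  simp only [h1, integral_const_mul, smul_eq_mul, abs_inv, abs_of_pos hs] at h
  rw [eq_div_iff (by positivity), pow_succ, ← mul_assoc, mul_comm _ (√m ^ k), h]
  field_simp

lemma exp_neg_mul_le_inv {δ : ℝ} (hδ : 0 < δ) {n : ℕ} (hn : 2 ≤ n) :
    Real.exp (-δ) ^ (n - 2) ≤ (Real.exp (2 * δ) / δ) / n := by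
  have hn0 : (0 : ℝ) < n := by exact_mod_cast (by omega : 0 < n)
  rw [← Real.exp_nat_mul, Nat.cast_sub hn, le_div_iff₀ hn0, le_div_iff₀ hδ]
  have h := Real.add_one_le_exp (δ * n)
  calc Real.exp (((n : ℝ) - (2 : ℕ)) * -δ) * n * δ
      ≤ Real.exp (((n : ℝ) - (2 : ℕ)) * -δ) * Real.exp (δ * n) := by
        rw [mul_assoc]; gcongr; linarith
    _ = Real.exp (2 * δ) := by rw [← Real.exp_add]; congr 1; push_cast; ring

lemma norm_pow_le_of_le_exp_neg {z : ℂ} {δ : ℝ} (h : ‖z‖ ≤ Real.exp (-δ)) {n : ℕ} (hn : 2 ≤ n) :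
    ‖z ^ n‖ ≤ Real.exp (-δ) ^ (n - 2) * ‖z‖ ^ 2 := by
  obtain ⟨k, rfl⟩ := Nat.exists_eq_add_of_le' hn
  rw [norm_pow, pow_add, Nat.add_sub_cancel]
  gcongr

/-- A modulus of continuity for the density of the sum, of order `1 / n`. The additive constant
cannot be dropped, as a bounded density need not have a Lipschitz convolution power. -/
lemma exists_abs_sumDensity_sub_le {C : ℝ} (hC : 0 < C) :
    ∃ D > 0, ∀ f, IsExpDominated C f → ∀ n : ℕ, 2 ≤ n → ∀ x x' : ℝ,
      |sumDensity f n x - sumDensity f n x'| ≤ D * (1 + |x - x'|) / n := by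
  obtain ⟨α, hα, v₁, hv₁, δ, hδ, B, hB, b, hb, hest⟩ := exists_fourier_estimates hC
  set J : ℝ := ∫ v : ℝ, |v| ^ 1 * Real.exp (-(α * v ^ 2)) with hJ
  have hJ0 : 0 ≤ J := integral_nonneg fun v => by positivity
  set E : ℝ := Real.exp (2 * δ) / δ with hE
  have hE0 : 0 < E := by positivity
  refine ⟨2 * Real.pi * J + 2 * E * C, by positivity, fun f hf n hn x x' => ?_⟩
  obtain ⟨s, -, hlow, hhigh⟩ := hest f hf
  have hb := hf.isBddDensity
  have hn0 : (0 : ℝ) < n := by exact_mod_cast (by omega : 0 < n)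
  set F := 𝓕 (fun x => (f x : ℂ)) with hF
  have hFi : ∀ x : ℝ, Integrable fun v : ℝ =>
      Complex.exp ((2 * Real.pi * v * x : ℝ) * Complex.I) * F v ^ n := fun x => by
    refine (hb.integrable_fourier_pow hn).bdd_mul (c := 1) (by fun_prop)
      (Eventually.of_forall fun v => ?_)
    rw [Complex.norm_exp_ofReal_mul_I]
  have hdiff : ((sumDensity f n x - sumDensity f n x' : ℝ) : ℂ)
      = ∫ v : ℝ, (Complex.exp ((2 * Real.pi * v * x : ℝ) * Complex.I) * F v ^ n
        - Complex.exp ((2 * Real.pi * v * x' : ℝ) * Complex.I) * F v ^ n) := by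
    rw [integral_sub (hFi x) (hFi x'), Complex.ofReal_sub, hb.sumDensity_eq_integral hn,
      hb.sumDensity_eq_integral hn]
  have hexp1 : ∀ v : ℝ, ‖Complex.exp ((2 * Real.pi * v * x : ℝ) * Complex.I)
      - Complex.exp ((2 * Real.pi * v * x' : ℝ) * Complex.I)‖ ≤ 2 * Real.pi * |x - x'| * |v| := by
    intro v
    have h1 : Complex.exp ((2 * Real.pi * v * x : ℝ) * Complex.I)
        - Complex.exp ((2 * Real.pi * v * x' : ℝ) * Complex.I)
        = Complex.exp ((2 * Real.pi * v * x' : ℝ) * Complex.I) *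
          (Complex.exp (Complex.I * (2 * Real.pi * v * (x - x') : ℝ)) - 1) := by
      rw [mul_sub, ← Complex.exp_add, mul_one]
      congr 2
      push_cast; ring
    rw [h1, norm_mul, Complex.norm_exp_ofReal_mul_I, one_mul]
    refine Real.norm_exp_I_mul_ofReal_sub_one_le.trans (le_of_eq ?_)
    rw [Real.norm_eq_abs, abs_mul, abs_mul, abs_of_pos Real.two_pi_pos]
    ring
  have hexp2 : ∀ v : ℝ, ‖Complex.exp ((2 * Real.pi * v * x : ℝ) * Complex.I)
      - Complex.exp ((2 * Real.pi * v * x' : ℝ) * Complex.I)‖ ≤ 2 := by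
    intro v
    refine (norm_sub_le _ _).trans ?_
    rw [Complex.norm_exp_ofReal_mul_I, Complex.norm_exp_ofReal_mul_I]
    norm_num
  have hi1 : Integrable fun v : ℝ =>
      2 * Real.pi * |x - x'| * (|v| ^ 1 * Real.exp (-(α * n * v ^ 2))) :=
    (integrable_abs_pow_mul_exp_neg_mul_sq (by positivity) 1).const_mul _
  have hi2 : Integrable fun v : ℝ => 2 * (Real.exp (-δ) ^ (n - 2) * ‖F v‖ ^ 2) :=
    (hb.integrable_norm_sq_fourier.1.const_mul _).const_mul _
  have hpt : ∀ v : ℝ, ‖Complex.exp ((2 * Real.pi * v * x : ℝ) * Complex.I) * F v ^ n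
        - Complex.exp ((2 * Real.pi * v * x' : ℝ) * Complex.I) * F v ^ n‖
      ≤ 2 * Real.pi * |x - x'| * (|v| ^ 1 * Real.exp (-(α * n * v ^ 2)))
        + 2 * (Real.exp (-δ) ^ (n - 2) * ‖F v‖ ^ 2) := by
    intro v
    rw [← sub_mul, norm_mul]
    rcases le_total |v| v₁ with h | h
    · have h1 : ‖F v ^ n‖ ≤ Real.exp (-(α * n * v ^ 2)) := by
        rw [norm_pow]
        refine (pow_le_pow_left₀ (norm_nonneg _) (hlow v h).1 n).trans (le_of_eq ?_)
        rw [← Real.exp_nat_mul]; congr 1; ring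
      have h2 := mul_le_mul (hexp1 v) h1 (norm_nonneg _) (by positivity)
      have h3 : 0 ≤ 2 * (Real.exp (-δ) ^ (n - 2) * ‖F v‖ ^ 2) := by positivity
      rw [pow_one]
      linarith
    · have h2 := mul_le_mul (hexp2 v) (norm_pow_le_of_le_exp_neg (hhigh v h) hn)
        (norm_nonneg _) (by norm_num)
      have h3 : 0 ≤ 2 * Real.pi * |x - x'| * (|v| ^ 1 * Real.exp (-(α * n * v ^ 2))) := by
        positivity
      linarith
  have hmain := norm_integral_le_of_norm_le (hi1.add hi2) (Eventually.of_forall hpt)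
  rw [← hdiff, Complex.norm_real, Real.norm_eq_abs, integral_add' hi1 hi2, integral_const_mul,
    integral_const_mul, integral_const_mul, integral_abs_pow_mul_exp_neg_mul_sq hn0,
    Real.sq_sqrt hn0.le, ← hJ] at hmain
  have hE2 := exp_neg_mul_le_inv hδ hn
  rw [← hE] at hE2
  have h5 : Real.exp (-δ) ^ (n - 2) * ∫ v, ‖F v‖ ^ 2 ≤ E / n * C :=
    mul_le_mul hE2 hb.integrable_norm_sq_fourier.2 (integral_nonneg fun v => by positivity)
      (by positivity)
  calc _ ≤ 2 * Real.pi * |x - x'| * (J / n) + 2 * (E / n * C) := by linarith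
    _ = (2 * Real.pi * J * |x - x'| + 2 * E * C) / n := by ring
    _ ≤ _ := by
      gcongr
      have : 0 ≤ 2 * E * C * |x - x'| + 2 * Real.pi * J := by positivity
      nlinarith

lemma norm_pow_sub_pow_le {z w : ℂ} {ρ : ℝ} (hz : ‖z‖ ≤ ρ) (hw : ‖w‖ ≤ ρ) (n : ℕ) :
    ‖z ^ n - w ^ n‖ ≤ n * ‖z - w‖ * ρ ^ (n - 1) := by
  have hρ : 0 ≤ ρ := (norm_nonneg z).trans hz
  rw [← (Commute.all z w).geom_sum₂_mul, norm_mul]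
  have h : ‖∑ i ∈ Finset.range n, z ^ i * w ^ (n - 1 - i)‖ ≤ n * ρ ^ (n - 1) := by
    refine (norm_sum_le_of_le _ (fun i hi => ?_)).trans_eq
      (by rw [Finset.sum_const, Finset.card_range, nsmul_eq_mul])
    rw [norm_mul, norm_pow, norm_pow]
    have hi' : i + (n - 1 - i) = n - 1 := by have := Finset.mem_range.1 hi; omega
    calc ‖z‖ ^ i * ‖w‖ ^ (n - 1 - i) ≤ ρ ^ i * ρ ^ (n - 1 - i) := by gcongr
      _ = ρ ^ (n - 1) := by rw [← pow_add, hi']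
  calc _ ≤ n * ρ ^ (n - 1) * ‖z - w‖ := by gcongr
    _ = _ := by ring

/-- The density of the sum is at least of order `1 / √n` at its mean: near the origin the `n`-th
power of the Fourier transform is close to that of a positive quadratic function. -/
lemma exists_le_sumDensity_zero {C : ℝ} (hC : 0 < C) :
    ∃ c > 0, ∀ᶠ n : ℕ in atTop, ∀ f, IsExpDominated C f → c / √n ≤ sumDensity f n 0 := by
  obtain ⟨α, hα, v₁, hv₁, δ, hδ, B, hB, b, hb0, hest⟩ := exists_fourier_estimates hC
  set J : ℝ := ∫ v : ℝ, |v| ^ 3 * Real.exp (-(α / 2 * v ^ 2)) with hJ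
  have hJ0 : 0 ≤ J := integral_nonneg fun v => by positivity
  set E : ℝ := Real.exp (2 * δ) / δ with hE
  have hE0 : 0 < E := by positivity
  -- for `|v| ≤ κ / √n` Bernoulli's inequality gives `(1 - s v²) ^ n ≥ 1 / 2`
  set κ : ℝ := min v₁ (1 / √(2 * b)) with hκ
  have hκ0 : 0 < κ := by positivity
  have hκ2 : b * κ ^ 2 ≤ 1 / 2 := by
    have h1 : κ ≤ 1 / √(2 * b) := min_le_right _ _
    have h2 := pow_le_pow_left₀ hκ0.le h1 2
    rw [div_pow, one_pow, Real.sq_sqrt (by positivity)] at h2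
    calc b * κ ^ 2 ≤ b * (1 / (2 * b)) := by gcongr
      _ = 1 / 2 := by field_simp
  have hlarge : ∀ᶠ n : ℕ in atTop, 2 * (B * J + E * C) / κ ≤ √(n : ℝ) :=
    (Real.tendsto_sqrt_atTop.comp tendsto_natCast_atTop_atTop).eventually_ge_atTop _
  refine ⟨κ / 2, by positivity, ?_⟩
  filter_upwards [hlarge, eventually_ge_atTop 2] with n hnl hn f hf
  obtain ⟨s, hsb, hlow, hhigh⟩ := hest f hf
  have hb := hf.isBddDensity
  have hn0 : (0 : ℝ) < n := by exact_mod_cast (by omega : 0 < n)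
  have hsq : 0 < √(n : ℝ) := Real.sqrt_pos.2 hn0
  have hsq1 : 1 ≤ √(n : ℝ) := by
    rw [Real.one_le_sqrt]; exact_mod_cast (by omega : 1 ≤ n)
  set F := 𝓕 (fun x => (f x : ℂ)) with hF
  have hS : sumDensity f n 0 = ∫ v, (F v ^ n).re := by
    have h1 := hb.sumDensity_eq_integral hn 0
    simp only [mul_zero, Complex.ofReal_zero, zero_mul, Complex.exp_zero, one_mul] at h1
    have h2 := integral_re (hb.integrable_fourier_pow hn)
    simp only [RCLike.re_to_complex] at h2
    rw [h2, ← h1, Complex.ofReal_re]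
  have hi0 : Integrable (indicator (Icc (-(κ / √n)) (κ / √n)) fun _ : ℝ => (1 / 2 : ℝ)) :=
    (integrable_indicator_iff measurableSet_Icc).2
      (integrableOn_const (by simp [Real.volume_Icc]))
  have hi1 : Integrable fun v : ℝ => n * B * (|v| ^ 3 * Real.exp (-(α / 2 * n * v ^ 2))) :=
    (integrable_abs_pow_mul_exp_neg_mul_sq (by positivity) 3).const_mul _
  have hi2 : Integrable fun v : ℝ => Real.exp (-δ) ^ (n - 2) * ‖F v‖ ^ 2 :=
    hb.integrable_norm_sq_fourier.1.const_mul _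
  have hpt : ∀ v : ℝ, indicator (Icc (-(κ / √n)) (κ / √n)) (fun _ : ℝ => (1 / 2 : ℝ)) v
      - n * B * (|v| ^ 3 * Real.exp (-(α / 2 * n * v ^ 2)))
      - Real.exp (-δ) ^ (n - 2) * ‖F v‖ ^ 2 ≤ (F v ^ n).re := by
    intro v
    have hp1 : 0 ≤ n * B * (|v| ^ 3 * Real.exp (-(α / 2 * n * v ^ 2))) := by positivity
    have hp2 : 0 ≤ Real.exp (-δ) ^ (n - 2) * ‖F v‖ ^ 2 := by positivity
    rcases le_or_gt |v| v₁ with h | h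
    · obtain ⟨h1, h2, h3, h4⟩ := hlow v h
      have hr : ‖((1 - s * v ^ 2 : ℝ) : ℂ)‖ ≤ Real.exp (-(α * v ^ 2)) := by
        rw [Complex.norm_real, Real.norm_of_nonneg h2]; exact h3
      have h5 := norm_pow_sub_pow_le h1 hr n
      have h6 : Real.exp (-(α * v ^ 2)) ^ (n - 1) ≤ Real.exp (-(α / 2 * n * v ^ 2)) := by
        rw [← Real.exp_nat_mul, Nat.cast_sub (by omega)]
        refine Real.exp_le_exp.2 ?_
        have : (2 : ℝ) ≤ n := by exact_mod_cast hn
        have h7 : 0 ≤ α * v ^ 2 := by positivity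
        push_cast
        nlinarith
      have h7 : ‖F v ^ n - ((1 - s * v ^ 2 : ℝ) : ℂ) ^ n‖
          ≤ n * B * (|v| ^ 3 * Real.exp (-(α / 2 * n * v ^ 2))) := by
        refine h5.trans ?_
        calc _ ≤ n * (B * |v| ^ 3) * Real.exp (-(α / 2 * n * v ^ 2)) := by gcongr
          _ = _ := by ring
      have h8 := (abs_le.1 ((Complex.abs_re_le_norm _).trans h7)).1
      rw [Complex.sub_re, ← Complex.ofReal_pow, Complex.ofReal_re] at h8
      have h9 : indicator (Icc (-(κ / √n)) (κ / √n)) (fun _ : ℝ => (1 / 2 : ℝ)) v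
          ≤ (1 - s * v ^ 2) ^ n := by
        by_cases hv : v ∈ Icc (-(κ / √n)) (κ / √n)
        · rw [indicator_of_mem hv]
          have h10 : v ^ 2 ≤ κ ^ 2 / n := by
            have := pow_le_pow_left₀ (abs_nonneg v) (abs_le.2 hv) 2
            rwa [sq_abs, div_pow, Real.sq_sqrt hn0.le] at this
          have h11 : s * v ^ 2 ≤ 1 / 2 / n := by
            calc s * v ^ 2 ≤ b * (κ ^ 2 / n) := by
                  refine (mul_le_mul_of_nonneg_right hsb (sq_nonneg v)).trans ?_
                  gcongr
              _ = b * κ ^ 2 / n := by ring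
              _ ≤ _ := by gcongr
          have h12 := one_add_mul_le_pow (a := -(s * v ^ 2)) (by linarith) n
          rw [← sub_eq_add_neg] at h12
          rw [le_div_iff₀ hn0] at h11
          nlinarith
        · rw [indicator_of_notMem hv]
          positivity
      linarith
    · have h1 : v ∉ Icc (-(κ / √n)) (κ / √n) := by
        intro hv
        have h2 : |v| ≤ κ / √n := abs_le.2 hv
        have h3 : κ / √n ≤ κ := div_le_self hκ0.le hsq1
        have h4 : κ ≤ v₁ := min_le_left _ _
        linarith
      rw [indicator_of_notMem h1]
      have h2 := norm_pow_le_of_le_exp_neg (hhigh v h.le) hn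
      have h3 := (abs_le.1 ((Complex.abs_re_le_norm _).trans h2)).1
      linarith
  have hmain := integral_mono ((hi0.sub hi1).sub hi2)
    (hb.integrable_fourier_pow hn).re (fun v => by simpa using hpt v)
  simp only [RCLike.re_to_complex] at hmain
  rw [← hS, integral_sub' (hi0.sub hi1) hi2, integral_sub' hi0 hi1,
    integral_indicator measurableSet_Icc, setIntegral_const, Real.volume_real_Icc,
    integral_const_mul, integral_const_mul, integral_abs_pow_mul_exp_neg_mul_sq hn0, ← hJ,
    max_eq_left (by have : 0 < κ / √n := by positivity
                    linarith), smul_eq_mul] at hmain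
  have hE2 := exp_neg_mul_le_inv hδ hn
  rw [← hE] at hE2
  have h5 : Real.exp (-δ) ^ (n - 2) * ∫ v, ‖F v‖ ^ 2 ≤ E / n * C :=
    mul_le_mul hE2 hb.integrable_norm_sq_fourier.2 (integral_nonneg fun v => by positivity)
      (by positivity)
  have h6 : √(n : ℝ) ^ (3 + 1) = (n : ℝ) ^ 2 := by
    rw [show 3 + 1 = 2 * 2 from rfl, pow_mul, Real.sq_sqrt hn0.le]
  rw [h6] at hmain
  have h7 : (B * J + E * C) / n ≤ κ / 2 / √n := by
    rw [div_le_iff₀ hκ0] at hnl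
    rw [div_le_div_iff₀ hn0 hsq]
    nth_rw 2 [← Real.mul_self_sqrt hn0.le]
    nlinarith
  have h8 : (n : ℝ) * B * (J / n ^ 2) = B * J / n := by field_simp
  have h9 : (B * J + E * C) / n = B * J / n + E / n * C := by ring
  have h10 : (κ / √n - -(κ / √n)) * (1 / 2) = κ / 2 / √n + κ / 2 / √n := by ring
  rw [h8, h10] at hmain
  linarith

lemma sumDensity_succ {f : ℝ → ℝ} {n : ℕ} (hn : 2 ≤ n) (x : ℝ) :
    sumDensity f n x = ∫ y, f y * sumDensity f (n - 1) (x - y) := by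
  obtain ⟨k, rfl⟩ := Nat.exists_eq_add_of_le' hn
  rfl

/-- The conditional density of a summand given that the sum equals its mean is within `O(1 / √n)`
of the density of the summand in `L¹`, uniformly over the densities bounded by `C exp (-|y|)`. -/
theorem exists_integral_abs_cond_sub_le {C : ℝ} (hC : 0 < C) :
    ∃ D, ∀ᶠ n : ℕ in atTop, ∀ f, IsExpDominated C f → 0 < sumDensity f n 0 ∧
      ∫ y, |f y * sumDensity f (n - 1) (-y) / sumDensity f n 0 - f y| ≤ D / √n := by
  obtain ⟨D, hD, hmod⟩ := exists_abs_sumDensity_sub_le hC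
  obtain ⟨c, hc, hlow⟩ := exists_le_sumDensity_zero hC
  have hM := expMoment_nonneg 1
  refine ⟨2 * D * (1 + 2 * (C * expMoment 1)) / c, ?_⟩
  filter_upwards [hlow, eventually_ge_atTop 3] with n hnl hn f hf
  have hb := hf.isBddDensity
  have hn0 : (0 : ℝ) < n := by exact_mod_cast (by omega : 0 < n)
  have hsq : 0 < √(n : ℝ) := Real.sqrt_pos.2 hn0
  have hS0 := hnl f hf
  have hSpos : 0 < sumDensity f n 0 := lt_of_lt_of_le (by positivity) hS0
  refine ⟨hSpos, ?_⟩
  set S := sumDensity f (n - 1) with hSdef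
  have hSd : IsBddDensity C S := hb.sumDensity (n - 1) (by omega)
  have hrec : sumDensity f n 0 = ∫ z, f z * S (-z) := by
    rw [sumDensity_succ (by omega)]; simp [hSdef]
  have hiS : Integrable fun z => f z * S (-z) := by simpa using hb.integrable_mul hSd 0
  have hia : Integrable fun y => |y| * f y := by simpa using hf.integrable_abs_pow 1
  have hma : ∫ y, |y| * f y ≤ C * expMoment 1 := by simpa using hf.integral_abs_pow_le 1
  have hmod' : ∀ x x', |S x - S x'| ≤ 2 * D / n * (1 + |x - x'|) := by
    intro x x'
    refine (hmod f hf (n - 1) (by omega) x x').trans ?_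
    rw [Nat.cast_sub (by omega), Nat.cast_one]
    have h3 : (3 : ℝ) ≤ n := by exact_mod_cast hn
    have h1 : 1 / ((n : ℝ) - 1) ≤ 2 / n := by
      rw [div_le_div_iff₀ (by linarith) hn0]; linarith
    have h2 := mul_le_mul_of_nonneg_left h1 (show 0 ≤ D * (1 + |x - x'|) by positivity)
    calc _ = D * (1 + |x - x'|) * (1 / ((n : ℝ) - 1)) := by ring
      _ ≤ _ := h2
      _ = _ := by ring
  -- the value at zero of the density of the sum is an average of the values `S (-z)`
  have hpt : ∀ y, |S (-y) - sumDensity f n 0| ≤ 2 * D / n * (1 + |y| + C * expMoment 1) := by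
    intro y
    have h1 : S (-y) - sumDensity f n 0 = ∫ z, (S (-y) * f z - f z * S (-z)) := by
      rw [integral_sub (hb.integrable.const_mul _) hiS, integral_const_mul, hf.mass, hrec, mul_one]
    have hi : Integrable fun z => 2 * D / n * ((1 + |y|) * f z + |z| * f z) :=
      ((hb.integrable.const_mul _).add hia).const_mul _
    rw [h1, ← Real.norm_eq_abs]
    refine (norm_integral_le_of_norm_le hi (Eventually.of_forall fun z => ?_)).trans ?_
    · rw [mul_comm (S (-y)), ← mul_sub, norm_mul, Real.norm_of_nonneg (hf.nonneg z),
        Real.norm_eq_abs]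
      have h2 := hmod' (-y) (-z)
      have h3 : |(-y) - (-z)| ≤ |y| + |z| := by
        rw [show -y - -z = z - y by ring, add_comm]; exact abs_sub _ _
      calc f z * |S (-y) - S (-z)| ≤ f z * (2 * D / n * (1 + (|y| + |z|))) := by
            refine mul_le_mul_of_nonneg_left (h2.trans ?_) (hf.nonneg z)
            gcongr
        _ = _ := by ring
    · rw [integral_const_mul, integral_add (hb.integrable.const_mul _) hia, integral_const_mul,
        hf.mass, mul_one]
      gcongr
  have hi : Integrable fun y => 2 * D / (c * √n) * ((1 + C * expMoment 1) * f y + |y| * f y) :=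
    ((hb.integrable.const_mul _).add hia).const_mul _
  have hbound : ∀ y, |f y * S (-y) / sumDensity f n 0 - f y|
      ≤ 2 * D / (c * √n) * ((1 + C * expMoment 1) * f y + |y| * f y) := by
    intro y
    have h1 : f y * S (-y) / sumDensity f n 0 - f y
        = f y * (S (-y) - sumDensity f n 0) / sumDensity f n 0 := by
      field_simp
    rw [h1, abs_div, abs_of_pos hSpos, abs_mul, abs_of_nonneg (hf.nonneg y)]
    calc f y * |S (-y) - sumDensity f n 0| / sumDensity f n 0
        ≤ f y * (2 * D / n * (1 + |y| + C * expMoment 1)) / (c / √n) := by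
          refine div_le_div₀ ?_ (mul_le_mul_of_nonneg_left (hpt y) (hf.nonneg y)) (by positivity) hS0
          exact mul_nonneg (hf.nonneg y) (by positivity)
      _ = _ := by
          have h2 : √(n : ℝ) ^ 2 = n := Real.sq_sqrt hn0.le
          field_simp
          rw [h2]
          ring
  calc ∫ y, |f y * S (-y) / sumDensity f n 0 - f y|
      ≤ ∫ y, 2 * D / (c * √n) * ((1 + C * expMoment 1) * f y + |y| * f y) := by
        refine integral_mono_of_nonneg (Eventually.of_forall fun y => abs_nonneg _) hi
          (Eventually.of_forall hbound)
    _ ≤ 2 * D / (c * √n) * (1 + 2 * (C * expMoment 1)) := by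
        rw [integral_const_mul, integral_add (hb.integrable.const_mul _) hia, integral_const_mul,
          hf.mass, mul_one]
        refine mul_le_mul_of_nonneg_left ?_ (by positivity)
        linarith
    _ = _ := by field_simp

/-! ### Regularity of the tail -/

lemma IsR0Rep.continuousOn_div {l ε : ℝ → ℝ} (h : IsR0Rep l ε) :
    ContinuousOn (fun u => ε u / u) (Ici 1) :=
  h.diff.continuousOn.div continuousOn_id fun _ hx => (zero_lt_one.trans_le hx).ne'

lemma IsR0Rep.pos {l ε : ℝ → ℝ} (h : IsR0Rep l ε) {x : ℝ} (hx : 1 ≤ x) : 0 < l x := by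
  rw [h.rep x hx]; exact Real.exp_pos _

/-- Potter-type bounds: a slowly varying function varies less than any power. -/
lemma IsR0Rep.exists_rpow_bounds {l ε : ℝ → ℝ} (h : IsR0Rep l ε) {η : ℝ} (hη : 0 < η) :
    ∃ X ≥ 1, ∀ x y, X ≤ x → x ≤ y →
      l x * (y / x) ^ (-η) ≤ l y ∧ l y ≤ l x * (y / x) ^ η := by
  obtain ⟨X, hX⟩ := eventually_atTop.1
    (h.tendsto_zero.eventually (Icc_mem_nhds (neg_lt_zero.2 hη) hη))
  refine ⟨max X 1, le_max_right _ _, fun x y hx hxy => ?_⟩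
  have hx1 : 1 ≤ x := (le_max_right _ _).trans hx
  have hx0 : 0 < x := zero_lt_one.trans_le hx1
  have hy0 : 0 < y := hx0.trans_le hxy
  have hi : ∀ a b, 1 ≤ a → 1 ≤ b → IntervalIntegrable (fun u => ε u / u) volume a b :=
    fun a b ha hb => (h.continuousOn_div.mono fun u hu =>
      (le_min ha hb).trans hu.1).intervalIntegrable
  have hly : l y = l x * Real.exp (∫ u in x..y, ε u / u) := by
    rw [h.rep x hx1, h.rep y (hx1.trans hxy), ← Real.exp_add,
      intervalIntegral.integral_add_adjacent_intervals (hi _ _ le_rfl hx1)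
        (hi _ _ hx1 (hx1.trans hxy))]
  have hlog : ∫ u in x..y, 1 / u = Real.log (y / x) := integral_one_div_of_pos hx0 hy0
  have hci : ∀ k : ℝ, IntervalIntegrable (fun u => k * (1 / u)) volume x y := fun k => by
    refine ContinuousOn.intervalIntegrable (continuousOn_const.mul
      (continuousOn_const.div continuousOn_id fun u hu => ?_))
    rw [uIcc_of_le hxy] at hu
    exact (hx0.trans_le hu.1).ne'
  have hup : ∫ u in x..y, ε u / u ≤ η * Real.log (y / x) := by
    rw [← hlog, ← intervalIntegral.integral_const_mul]
    refine intervalIntegral.integral_mono_on hxy (hi _ _ hx1 (hx1.trans hxy)) (hci η) fun u hu => ?_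
    have hu0 : 0 < u := hx0.trans_le hu.1
    rw [mul_one_div]
    exact div_le_div_of_nonneg_right (hX u ((le_max_left _ _).trans (hx.trans hu.1))).2 hu0.le
  have hdown : -η * Real.log (y / x) ≤ ∫ u in x..y, ε u / u := by
    rw [← hlog, ← intervalIntegral.integral_const_mul]
    refine intervalIntegral.integral_mono_on hxy (hci (-η)) (hi _ _ hx1 (hx1.trans hxy)) fun u hu => ?_
    have hu0 : 0 < u := hx0.trans_le hu.1
    rw [mul_one_div]
    exact div_le_div_of_nonneg_right (hX u ((le_max_left _ _).trans (hx.trans hu.1))).1 hu0.le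
  have hlx := h.pos hx1
  rw [hly, Real.rpow_def_of_pos (by positivity), Real.rpow_def_of_pos (by positivity)]
  exact ⟨by gcongr; linarith, by gcongr; linarith⟩

lemma exists_deriv_eq_slope_mul {g : ℝ → ℝ} (hg : DifferentiableOn ℝ g (Ioi 0)) {x y : ℝ}
    (hx : 0 < x) (hxy : x < y) : ∃ u ∈ Ioo x y, g y - g x = deriv g u * (y - x) := by
  obtain ⟨u, hu, he⟩ := exists_deriv_eq_slope g hxy
    (hg.continuousOn.mono fun u hu => hx.trans_le hu.1)
    (hg.mono fun u hu => hx.trans hu.1)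
  exact ⟨u, hu, by rw [he, div_mul_cancel₀ _ (sub_pos.2 hxy).ne']⟩

/-- The tangent line inequality for a function with monotone derivative on a half-line. -/
lemma tangent_le {g : ℝ → ℝ} (hg : DifferentiableOn ℝ g (Ioi 0)) {x₀ : ℝ} (hx₀ : 0 < x₀)
    (hm : MonotoneOn (deriv g) (Ici x₀)) {x y : ℝ} (hx : x₀ ≤ x) (hy : x₀ ≤ y) :
    g y + deriv g y * (x - y) ≤ g x := by
  rcases lt_trichotomy x y with h | rfl | h
  · obtain ⟨u, hu, he⟩ := exists_deriv_eq_slope_mul hg (hx₀.trans_le hx) h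
    have := hm (hx.trans hu.1.le : x₀ ≤ u) hy hu.2.le
    nlinarith [mul_le_mul_of_nonneg_right this (sub_nonneg.2 h.le)]
  · simp
  · obtain ⟨u, hu, he⟩ := exists_deriv_eq_slope_mul hg (hx₀.trans_le hy) h
    have := hm hy (hy.trans hu.1.le : x₀ ≤ u) hu.1.le
    nlinarith [mul_le_mul_of_nonneg_right this (sub_nonneg.2 h.le)]

lemma tendsto_deriv_atTop {g : ℝ → ℝ} (hg : DifferentiableOn ℝ g (Ioi 0))
    (hsup : Tendsto (fun x => g x / x) atTop atTop) {x₀ : ℝ} (hx₀ : 0 < x₀)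
    (hm : MonotoneOn (deriv g) (Ici x₀)) : Tendsto (deriv g) atTop atTop := by
  refine tendsto_atTop.2 fun A => ?_
  suffices h : ∃ x ≥ x₀, A ≤ deriv g x by
    obtain ⟨x, hx, hA⟩ := h
    filter_upwards [eventually_ge_atTop x] with y hy
    exact hA.trans (hm hx (hx.trans hy : x₀ ≤ y) hy)
  by_contra! hcon
  -- a bounded derivative would make `g` grow at most linearly
  obtain ⟨x, hx, hgx⟩ := ((eventually_gt_atTop x₀).and
    (hsup.eventually_gt_atTop (|A| + |g x₀| / x₀))).exists
  obtain ⟨u, hu, he⟩ := exists_deriv_eq_slope_mul hg hx₀ hx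
  have hx0 : 0 < x := hx₀.trans hx
  rw [lt_div_iff₀ hx0, add_mul] at hgx
  have h1 := hcon u hu.1.le
  have h2 : deriv g u * (x - x₀) ≤ |A| * x :=
    calc deriv g u * (x - x₀) ≤ |A| * (x - x₀) := by
          refine mul_le_mul_of_nonneg_right (h1.le.trans (le_abs_self A)) (by linarith)
      _ ≤ |A| * x := by gcongr; linarith
  have h3 : |g x₀| ≤ |g x₀| / x₀ * x := by
    rw [div_mul_eq_mul_div, le_div_iff₀ hx₀]
    exact mul_le_mul_of_nonneg_left hx.le (abs_nonneg _)
  linarith [le_abs_self (g x₀)]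

lemma ClassRBeta.exists_halving {β : ℝ} {h : ℝ → ℝ} (H : ClassRBeta β h) :
    ∃ x₀ > 0, MonotoneOn h (Ici x₀) ∧ ∃ κ, 0 ≤ κ ∧ κ < 1 ∧
      ∀ x, 2 * x₀ ≤ x → h (x / 2) ≤ κ * h x := by
  obtain ⟨hβ, l, ε, hrep, -, -, heq⟩ := H
  obtain ⟨X, hX1, hX⟩ := hrep.exists_rpow_bounds (half_pos hβ)
  obtain ⟨Y, hY⟩ := eventually_atTop.1 heq
  set x₀ := max X Y with hx₀
  have hx1 : 1 ≤ x₀ := hX1.trans (le_max_left _ _)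
  have hpos : ∀ x, x₀ ≤ x → 0 < h x := fun x hx => by
    rw [hY x ((le_max_right _ _).trans hx)]
    exact mul_pos (Real.rpow_pos_of_pos (by linarith) _) (hrep.pos (hx1.trans hx))
  have key : ∀ x y, x₀ ≤ x → x ≤ y → h x * (y / x) ^ (β / 2) ≤ h y := by
    intro x y hx hxy
    have hx0 : 0 < x := by linarith
    have hy0 : 0 < y := by linarith
    have h1 := (hX x y ((le_max_left _ _).trans hx) hxy).1
    rw [hY x ((le_max_right _ _).trans hx), hY y ((le_max_right _ _).trans (hx.trans hxy))]
    have h2 : y ^ β = x ^ β * (y / x) ^ β := by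
      rw [← Real.mul_rpow hx0.le (by positivity), mul_div_cancel₀ _ hx0.ne']
    have h3 : (y / x) ^ (β / 2) = (y / x) ^ β * (y / x) ^ (-(β / 2)) := by
      rw [← Real.rpow_add (by positivity)]; congr 1; ring
    rw [h2, h3]
    calc _ = x ^ β * (y / x) ^ β * (l x * (y / x) ^ (-(β / 2))) := by ring
      _ ≤ _ := by gcongr
  refine ⟨x₀, by linarith, fun x hx y _ hxy => ?_, (2 : ℝ) ^ (-(β / 2)), by positivity, ?_,
    fun x hx => ?_⟩
  · refine le_trans ?_ (key x y hx hxy)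
    have hx0 : 0 < x := by linarith [mem_Ici.1 hx]
    refine le_mul_of_one_le_right (hpos x hx).le (Real.one_le_rpow ?_ (by positivity))
    rwa [one_le_div hx0]
  · exact Real.rpow_lt_one_of_one_lt_of_neg one_lt_two (by linarith)
  · have h1 := key (x / 2) x (by linarith) (by linarith)
    rw [show x / (x / 2) = 2 by have : x ≠ 0 := by linarith
                                field_simp] at h1
    rw [Real.rpow_neg (by norm_num), inv_mul_eq_div, le_div_iff₀ (by positivity)]
    exact h1

lemma psi_apply_of_strictMonoOn {h : ℝ → ℝ} (H : StrictMonoOn h (Ioi 0)) {x : ℝ} (hx : 0 < x) :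
    psi h (h x) = x := by
  have : {y | 0 < y ∧ h x ≤ h y} = Ici x := by
    ext y
    refine ⟨fun hy => (H.le_iff_le hx hy.1).1 hy.2, fun hy => ?_⟩
    have hy0 : 0 < y := hx.trans_le hy
    exact ⟨hy0, (H.le_iff_le hx hy0).2 hy⟩
  rw [psi, this, csInf_Ici]

lemma ClassRInfty.exists_halving {h : ℝ → ℝ} (H : ClassRInfty h) (htop : Tendsto h atTop atTop) :
    ∃ x₀ > 0, MonotoneOn h (Ici x₀) ∧ ∃ κ, 0 ≤ κ ∧ κ < 1 ∧
      ∀ x, 2 * x₀ ≤ x → h (x / 2) ≤ κ * h x := by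
  obtain ⟨hmono, ε, hrep, -⟩ := H
  obtain ⟨X, hX1, hX⟩ := hrep.exists_rpow_bounds (show (0 : ℝ) < 1 / 2 by norm_num)
  obtain ⟨Y, hY⟩ := eventually_atTop.1 (htop.eventually_ge_atTop (2 * X))
  refine ⟨max Y 1, by positivity, fun x hx y hy hxy => ?_, 1 / 2, by norm_num, by norm_num,
    fun x hx => ?_⟩
  · have h1 : (1 : ℝ) ≤ x := (le_max_right _ _).trans hx
    exact hmono.monotoneOn (mem_Ioi.2 (by linarith)) (mem_Ioi.2 (by linarith)) hxy
  · have hx1 : 1 ≤ x / 2 := by linarith [le_max_right Y 1]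
    have hxY : Y ≤ x := by linarith [le_max_left Y 1, le_max_right Y 1]
    have hx0 : 0 < x := by linarith
    have ht := hY x hxY
    have hX' := (hX (h x / 2) (h x) (by linarith) (by linarith)).2
    rw [psi_apply_of_strictMonoOn hmono hx0,
      show h x / (h x / 2) = 2 by have : h x ≠ 0 := by linarith
                                  field_simp] at hX'
    have hψ := hrep.pos (x := h x / 2) (by linarith)
    have h2 : (2 : ℝ) ^ (1 / 2 : ℝ) < 2 := by
      conv_rhs => rw [← Real.rpow_one 2]
      exact Real.rpow_lt_rpow_of_exponent_lt one_lt_two (by norm_num)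
    have h3 : x / 2 < psi h (h x / 2) := by nlinarith
    by_contra! hcon
    have h4 : psi h (h x / 2) ≤ x / 2 :=
      csInf_le ⟨0, fun y hy => hy.1.le⟩ ⟨by linarith, by linarith⟩
    linarith

namespace IsLightTail

variable {p g q : ℝ → ℝ} {c : ℝ}

/-- The properties of the tail that matter: beyond some `x₀` the derivative of `g` is monotone, it
shrinks by a fixed factor when the argument is halved, and `q` is bounded. -/
lemma exists_tail (hp : IsLightTail p g q c) :
    ∃ x₀ > 0, MonotoneOn (deriv g) (Ici x₀) ∧ (∀ x, x₀ ≤ x → 0 ≤ deriv g x) ∧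
      (∃ κ, 0 ≤ κ ∧ κ < 1 ∧ ∀ x, 2 * x₀ ≤ x → deriv g (x / 2) ≤ κ * deriv g x) ∧
      (∀ x, x₀ ≤ x → |q x| ≤ 1) ∧ Tendsto (deriv g) atTop atTop := by
  have hex : ∃ x₀ > 0, MonotoneOn (deriv g) (Ici x₀) ∧ ∃ κ, 0 ≤ κ ∧ κ < 1 ∧
      ∀ x, 2 * x₀ ≤ x → deriv g (x / 2) ≤ κ * deriv g x := by
    rcases hp.regular with ⟨β, h⟩ | h
    · exact h.exists_halving
    · exact h.exists_halving (tendsto_deriv_atTop hp.g_diff hp.g_superlinear zero_lt_one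
        (h.1.monotoneOn.mono (Ici_subset_Ioi.2 zero_lt_one)))
  obtain ⟨x₀, hx₀, hm, κ, hκ0, hκ1, hκ⟩ := hex
  have htop := tendsto_deriv_atTop hp.g_diff hp.g_superlinear hx₀ hm
  obtain ⟨θ, hθ, hq⟩ := hp.q_small
  obtain ⟨X, hX⟩ := eventually_atTop.1 (hq.and (htop.eventually_ge_atTop 1))
  set x₁ := max x₀ (max X 1) with hx₁
  have h0 : x₀ ≤ x₁ := le_max_left _ _
  have hX' : X ≤ x₁ := (le_max_left _ _).trans (le_max_right _ _)
  have h1 : 1 ≤ x₁ := (le_max_right _ _).trans (le_max_right _ _)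
  refine ⟨x₁, by linarith, hm.mono (Ici_subset_Ici.2 h0), fun x hx => ?_,
    ⟨κ, hκ0, hκ1, fun x hx => hκ x (by linarith)⟩, fun x hx => ?_, htop⟩
  · linarith [(hX x (hX'.trans hx)).2]
  · obtain ⟨h2, h3⟩ := hX x (hX'.trans hx)
    have hx0 : 0 < x := by linarith
    refine (h2 x hx0 (by simpa using mul_pos hθ hx0)).trans ?_
    rw [div_le_one (Real.sqrt_pos.2 (mul_pos hx0 (by linarith))), Real.one_le_sqrt]
    nlinarith

lemma isBddDensity (hp : IsLightTail p g q c) : ∃ M, IsBddDensity M p := by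
  obtain ⟨M, hM⟩ := hp.bounded
  have h1 : ∫⁻ x, ENNReal.ofReal (p x) = 1 := by
    have := hp.isProbabilityMeasure.measure_univ
    rwa [law, withDensity_apply _ MeasurableSet.univ, Measure.restrict_univ] at this
  have hint : Integrable p := by
    refine ⟨hp.measurable.aestronglyMeasurable, ?_⟩
    rw [hasFiniteIntegral_iff_ofReal (Eventually.of_forall hp.nonneg), h1]
    exact ENNReal.one_lt_top
  refine ⟨M, hp.measurable, hp.nonneg, hM, hint, ?_⟩
  rw [integral_eq_lintegral_of_nonneg_ae (Eventually.of_forall hp.nonneg)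
    hint.aestronglyMeasurable, h1, ENNReal.toReal_one]

end IsLightTail

lemma integral_law {p : ℝ → ℝ} (hm : Measurable p) (h0 : ∀ x, 0 ≤ p x) (F : ℝ → ℝ) :
    ∫ x, F x ∂(law p) = ∫ x, F x * p x := by
  rw [law, integral_withDensity_eq_integral_toReal_smul hm.ennreal_ofReal
    (Eventually.of_forall fun _ => ENNReal.ofReal_lt_top)]
  simp [ENNReal.toReal_ofReal (h0 _), mul_comm]

lemma integrable_law_iff {p : ℝ → ℝ} (hm : Measurable p) (h0 : ∀ x, 0 ≤ p x) (F : ℝ → ℝ) :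
    Integrable F (law p) ↔ Integrable fun x => F x * p x := by
  rw [law, integrable_withDensity_iff_integrable_smul' hm.ennreal_ofReal
    (Eventually.of_forall fun _ => ENNReal.ofReal_lt_top)]
  simp [ENNReal.toReal_ofReal (h0 _), mul_comm]

namespace IsLightTail

variable {p g q : ℝ → ℝ} {c : ℝ}

lemma mgf_eq (hp : IsLightTail p g q c) (t : ℝ) :
    mgf id (law p) t = ∫ x, Real.exp (t * x) * p x := by
  rw [mgf]; exact integral_law hp.measurable hp.nonneg _

lemma le_of_tail (hp : IsLightTail p g q c) {x : ℝ} (hx : 0 < x) (hq : |q x| ≤ 1) :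
    p x ≤ c * Real.exp 1 * Real.exp (-g x) := by
  have := hp.c_pos
  rw [hp.density_eq x hx, mul_assoc, ← Real.exp_add]
  gcongr
  linarith [(abs_le.1 hq).2]

lemma le_of_tail' (hp : IsLightTail p g q c) {x : ℝ} (hx : 0 < x) (hq : |q x| ≤ 1) :
    c * Real.exp (-1) * Real.exp (-g x) ≤ p x := by
  have := hp.c_pos
  rw [hp.density_eq x hx, mul_assoc, ← Real.exp_add]
  gcongr
  linarith [(abs_le.1 hq).1]

/-- All exponential moments of nonnegative order are finite, as `g` is superlinear. -/
lemma integrable_exp_mul (hp : IsLightTail p g q c) {t : ℝ} (ht : 0 ≤ t) :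
    Integrable fun x => Real.exp (t * x) * p x := by
  obtain ⟨M, hb⟩ := hp.isBddDensity
  obtain ⟨x₀, hx₀, -, -, -, hq, -⟩ := hp.exists_tail
  obtain ⟨X, hX⟩ := eventually_atTop.1 (hp.g_superlinear.eventually_ge_atTop (t + 1))
  have hc := hp.c_pos
  have hpm := hp.measurable
  have h0 : Integrable fun y : ℝ => Real.exp (-|y|) := by
    simpa using integrable_abs_pow_mul_exp_neg_abs 0
  refine ((hb.integrable.const_mul (Real.exp (t * max X x₀))).add
    (h0.const_mul (c * Real.exp 1))).mono' (by fun_prop) (Eventually.of_forall fun x => ?_)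
  rw [Real.norm_of_nonneg (mul_nonneg (Real.exp_pos _).le (hp.nonneg x))]
  rcases le_total x (max X x₀) with h | h
  · refine (mul_le_mul_of_nonneg_right ?_ (hp.nonneg x)).trans
      (le_add_of_nonneg_right (by positivity))
    gcongr
  · have hx0 : 0 < x := hx₀.trans_le ((le_max_right _ _).trans h)
    have h1 := hX x ((le_max_left _ _).trans h)
    rw [le_div_iff₀ hx0] at h1
    have h2 := hp.le_of_tail hx0 (hq x ((le_max_right _ _).trans h))
    refine le_trans ?_ (le_add_of_nonneg_left (mul_nonneg (Real.exp_pos _).le (hp.nonneg x)))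
    calc Real.exp (t * x) * p x
        ≤ Real.exp (t * x) * (c * Real.exp 1 * Real.exp (-g x)) := by gcongr
      _ = c * Real.exp 1 * Real.exp (t * x - g x) := by
          rw [sub_eq_add_neg, Real.exp_add]; ring
      _ ≤ c * Real.exp 1 * Real.exp (-|x|) := by
          rw [abs_of_pos hx0]; gcongr; linarith

end IsLightTail

/-! ### The shape of the tilted density -/

/-- A concave function, written as `t x - g x`, that drops by at least `1` at distance `r` from its
maximum on the relevant side decays at least linearly beyond. -/
lemma sub_le_of_drop {g : ℝ → ℝ} {t x z u r : ℝ} (hr : 0 < r)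
    (hx : g u + deriv g u * (x - u) ≤ g x) (hz : g u + deriv g u * (z - u) ≤ g z)
    (hu : |u - z| = r) (hxu : |x - z| = |x - u| + r) (hside : 0 ≤ (x - u) * (u - z))
    (hdrop : (t * u - g u) - (t * z - g z) ≤ -1) :
    (t * x - g x) - (t * z - g z) ≤ -(|x - z| / r) := by
  have h1 : 1 ≤ (deriv g u - t) * (u - z) := by linarith
  have hsq : (u - z) ^ 2 = r ^ 2 := by rw [← hu, sq_abs]
  have habs : |x - u| * r = (x - u) * (u - z) := by
    rw [← hu, ← abs_mul, abs_of_nonneg hside]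
  -- the slope of the tangent at `u` is at most `-1 / r`, measured away from `z`
  have h2 : |x - u| ≤ (deriv g u - t) * (x - u) * r := by
    have h3 : |x - u| * r * 1 ≤ |x - u| * r * ((deriv g u - t) * (u - z)) :=
      mul_le_mul_of_nonneg_left h1 (by positivity)
    have h4 : |x - u| * r * ((deriv g u - t) * (u - z))
        = (deriv g u - t) * (x - u) * r * r := by
      rw [habs]
      calc _ = (deriv g u - t) * (x - u) * (u - z) ^ 2 := by ring
        _ = _ := by rw [hsq]; ring
    rw [h4, mul_one] at h3
    exact le_of_mul_le_mul_right h3 hr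
  have h5 : |x - u| / r ≤ (deriv g u - t) * (x - u) := by rwa [div_le_iff₀ hr]
  have h6 : |x - z| / r = |x - u| / r + 1 := by rw [hxu, add_div, div_self hr.ne']
  rw [h6]
  linarith

lemma const_mul_le_integral {w : ℝ → ℝ} (hw : Integrable w) (h0 : ∀ x, 0 ≤ w x) {a b k : ℝ}
    (hab : a ≤ b) (hk : ∀ x ∈ Icc a b, k ≤ w x) : (b - a) * k ≤ ∫ x, w x := by
  have h1 : ∫ x in Icc a b, k ≤ ∫ x in Icc a b, w x :=
    setIntegral_mono_on (integrableOn_const (by simp [Real.volume_Icc])) hw.integrableOn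
      measurableSet_Icc hk
  rw [setIntegral_const, Real.volume_real_Icc, max_eq_left (by linarith), smul_eq_mul] at h1
  exact h1.trans (setIntegral_le_integral hw (Eventually.of_forall h0))

lemma exists_deriv_eq {g : ℝ → ℝ} (hg : DifferentiableOn ℝ g (Ioi 0))
    (htop : Tendsto (deriv g) atTop atTop) {Z t : ℝ} (hZ : 0 < Z) (ht : deriv g Z ≤ t) :
    ∃ z ≥ Z, deriv g z = t := by
  obtain ⟨y, hy, hty⟩ := ((eventually_ge_atTop Z).and (htop.eventually_ge_atTop t)).exists
  obtain ⟨z, hz, he⟩ := exists_hasDerivWithinAt_eq_of_ge_of_le (f := g) (f' := deriv g) hy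
    (fun x hx => ((hg x (hZ.trans_le hx.1)).differentiableAt
      (Ioi_mem_nhds (hZ.trans_le hx.1))).hasDerivAt.hasDerivWithinAt) ht hty
  exact ⟨z, hz.1, he⟩

namespace IsLightTail

variable {p g q : ℝ → ℝ} {c : ℝ}

lemma integral_exp_mul_pos (hp : IsLightTail p g q c) {t : ℝ} (ht : 0 ≤ t) :
    0 < ∫ x, Real.exp (t * x) * p x := by
  have := hp.isProbabilityMeasure
  rw [← hp.mgf_eq]
  exact mgf_pos ((integrable_law_iff hp.measurable hp.nonneg _).2 (hp.integrable_exp_mul ht))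

/-- For large `t` the tilted density, rescaled about some centre `z` by some `r > 0`, is at most
`C exp (-|y|)` with `C` independent of `t`. Here `z` maximises the exponent `G x = t x - g x` and
`r` is a multiple of `φ(t) / exp (G z)`. Since `G` is concave and the total mass is `φ(t)`, the
exponent has dropped by `1` at distance `r`, hence decays linearly beyond. To the left of the
region where `g` is convex the weight `exp (t x)` suffices, because `G z` exceeds a multiple of
`t z`. -/
lemma exists_rescaled_le (hp : IsLightTail p g q c) :
    ∃ C > 0, ∃ t₀ > 0, ∀ t, t₀ ≤ t → ∃ z, ∃ r > 0, ∀ x,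
      r * (Real.exp (t * x) * p x / ∫ x, Real.exp (t * x) * p x)
        ≤ C * Real.exp (-(|x - z| / r)) := by
  obtain ⟨M, hM⟩ := hp.isBddDensity
  obtain ⟨x₀, hx₀, hm, hpos, ⟨κ, hκ0, hκ1, hκ⟩, hq, htop⟩ := hp.exists_tail
  have hc := hp.c_pos
  have hM0 := hM.const_nonneg
  have htan : ∀ {x y}, x₀ ≤ x → x₀ ≤ y → g y + deriv g y * (x - y) ≤ g x :=
    fun hx hy => tangent_le hp.g_diff hx₀ hm hx hy
  -- `lam` is the constant in `t z - g z ≥ lam t z - g x₀`; the factor `A` slows the decay down so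
  -- that it also holds to the left of `x₀`
  set lam : ℝ := (1 - κ) / 2 with hlam
  have hlam0 : 0 < lam := by rw [hlam]; linarith
  have hlam1 : lam ≤ 1 / 2 := by rw [hlam]; linarith
  set A : ℝ := 2 / lam with hA
  have hA1 : 1 ≤ A := by rw [hA, le_div_iff₀ hlam0]; linarith
  set K : ℝ := max (c * Real.exp 2) (M * Real.exp (g x₀)) with hK
  have hK0 : 0 < K := lt_max_of_lt_left (by positivity)
  set Z : ℝ := max (2 * x₀ / lam) (x₀ + 1) with hZ
  have hZx : x₀ + 1 ≤ Z := le_max_right _ _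
  refine ⟨A * Real.exp 2 / c * K, by positivity, max (deriv g Z) 1, by positivity,
    fun t ht => ?_⟩
  have ht1 : 1 ≤ t := (le_max_right _ _).trans ht
  obtain ⟨z, hzZ, hz⟩ := exists_deriv_eq hp.g_diff htop (by linarith)
    ((le_max_left _ _).trans ht)
  have hzx : x₀ + 1 ≤ z := hZx.trans hzZ
  have hz1 : 2 * x₀ ≤ lam * z := by
    have : 2 * x₀ / lam ≤ z := (le_max_left _ _).trans hzZ
    rw [div_le_iff₀ hlam0] at this
    linarith
  set φ := ∫ x, Real.exp (t * x) * p x with hφ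
  have hφ0 : 0 < φ := hp.integral_exp_mul_pos (by linarith)
  have hw0 : ∀ x, 0 ≤ Real.exp (t * x) * p x := fun x =>
    mul_nonneg (Real.exp_pos _).le (hp.nonneg x)
  have hwi := hp.integrable_exp_mul (show 0 ≤ t by linarith)
  have hwlow : ∀ x, x₀ ≤ x →
      c * Real.exp (-1) * Real.exp (t * x - g x) ≤ Real.exp (t * x) * p x := fun x hx => by
    calc _ = Real.exp (t * x) * (c * Real.exp (-1) * Real.exp (-g x)) := by
          rw [sub_eq_add_neg, Real.exp_add]; ring
      _ ≤ _ := by gcongr; exact hp.le_of_tail' (by linarith) (hq x hx)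
  have hwup : ∀ x, x₀ ≤ x →
      Real.exp (t * x) * p x ≤ c * Real.exp 1 * Real.exp (t * x - g x) := fun x hx => by
    calc _ ≤ Real.exp (t * x) * (c * Real.exp 1 * Real.exp (-g x)) := by
          gcongr; exact hp.le_of_tail (by linarith) (hq x hx)
      _ = _ := by rw [sub_eq_add_neg, Real.exp_add]; ring
  set R := Real.exp (t * z - g z) with hR
  have hR0 : 0 < R := Real.exp_pos _
  -- at this scale a drop of the exponent by less than `1` over an interval of length `r₁` would
  -- exceed the total mass `φ`
  set r₁ := Real.exp 2 / c * (φ / R) with hr₁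
  have hr₁0 : 0 < r₁ := by positivity
  have hφr : φ = c * Real.exp (-2) * R * r₁ := by
    rw [hr₁, Real.exp_neg]; field_simp
  -- as `g` is nondecreasing, the exponent drops by at most `1` on `[z - 1 / t, z]`
  have hr₁t : 1 / t ≤ r₁ := by
    have hlt : 1 / t ≤ 1 := (div_le_one (by linarith)).2 ht1
    have h1 := const_mul_le_integral (a := z - 1 / t) (b := z) hwi hw0
      (by have : 0 < 1 / t := by positivity
          linarith) (k := c * Real.exp (-2) * R) fun x hx => by
        have hxx : x₀ ≤ x := by linarith [hx.1]
        refine le_trans ?_ (hwlow x hxx)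
        have hgx : g x ≤ g z := by
          have := htan (show x₀ ≤ z by linarith) hxx
          have := mul_nonneg (hpos x hxx) (sub_nonneg.2 hx.2)
          linarith
        have htx : t * (z - x) ≤ 1 := by
          have h2 : z - x ≤ 1 / t := by linarith [hx.1]
          rw [le_div_iff₀ (by linarith)] at h2
          linarith
        rw [hR, mul_assoc, mul_assoc, ← Real.exp_add]
        refine mul_le_mul_of_nonneg_left ?_ hc.le
        rw [← Real.exp_add]
        exact Real.exp_le_exp.2 (by linarith)
    rw [← hφ, sub_sub_cancel, hφr] at h1
    have : 0 < c * Real.exp (-2) * R := by positivity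
    exact le_of_mul_le_mul_left (by linarith) this
  -- the exponent drops by one at distance `r₁` from its maximum, by comparison of masses
  have hdrop : ∀ a b u, a ≤ b → b - a = r₁ → (∀ x ∈ Icc a b, x₀ ≤ x ∧
      t * u - g u ≤ t * x - g x) → (t * u - g u) - (t * z - g z) ≤ -1 := by
    intro a b u hab hba hu
    have h1 := const_mul_le_integral hwi hw0 hab
      (k := c * Real.exp (-1) * Real.exp (t * u - g u)) fun x hx => by
        refine le_trans ?_ (hwlow x (hu x hx).1)
        exact mul_le_mul_of_nonneg_left (Real.exp_le_exp.2 (hu x hx).2) (by positivity)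
    rw [← hφ, hφr, hba] at h1
    have h2 : Real.exp (-1) * Real.exp (t * u - g u) ≤ Real.exp (-2) * R := by
      have : 0 < c * r₁ := by positivity
      exact le_of_mul_le_mul_left (by linarith) this
    rw [hR, ← Real.exp_add, ← Real.exp_add, Real.exp_le_exp] at h2
    linarith
  have hdecay : ∀ x, x₀ ≤ x → (t * x - g x) - (t * z - g z) ≤ 1 - |x - z| / r₁ := by
    intro x hx
    rcases le_or_gt |x - z| r₁ with h | h
    · have h1 := htan hx (show x₀ ≤ z by linarith)
      rw [hz] at h1
      have h2 : |x - z| / r₁ ≤ 1 := (div_le_one hr₁0).2 h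
      linarith
    · rcases le_total z x with hzx' | hzx'
      · rw [abs_of_nonneg (by linarith)] at h
        have hd := hdrop z (z + r₁) (z + r₁) (by linarith) (by ring) fun y hy => by
          have hy0 : x₀ ≤ y := by linarith [hy.1]
          have h1 := htan (show x₀ ≤ z + r₁ by linarith) hy0
          have h2 : t ≤ deriv g y := hz ▸ hm (show x₀ ≤ z by linarith) hy0 hy.1
          have h3 := mul_le_mul_of_nonneg_right h2 (sub_nonneg.2 hy.2)
          exact ⟨hy0, by linarith⟩
        have h4 := sub_le_of_drop (x := x) hr₁0 (htan hx (show x₀ ≤ z + r₁ by linarith))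
          (htan (show x₀ ≤ z by linarith) (show x₀ ≤ z + r₁ by linarith))
          (by rw [add_sub_cancel_left, abs_of_pos hr₁0])
          (by rw [abs_of_nonneg (by linarith), abs_of_nonneg (by linarith)]; ring)
          (mul_nonneg (by linarith) (by linarith)) hd
        linarith
      · rw [abs_of_nonpos (by linarith)] at h
        have hd := hdrop (z - r₁) z (z - r₁) (by linarith) (by ring) fun y hy => by
          have hy0 : x₀ ≤ y := by linarith [hy.1]
          have h1 := htan (show x₀ ≤ z - r₁ by linarith) hy0
          have h2 : deriv g y ≤ t := hz ▸ hm hy0 (show x₀ ≤ z by linarith) hy.2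
          have h3 := mul_le_mul_of_nonneg_right h2 (sub_nonneg.2 hy.1)
          exact ⟨hy0, by linarith⟩
        have h4 := sub_le_of_drop (x := x) hr₁0 (htan hx (show x₀ ≤ z - r₁ by linarith))
          (htan (show x₀ ≤ z by linarith) (show x₀ ≤ z - r₁ by linarith))
          (by rw [abs_of_nonpos (by linarith)]; ring)
          (by rw [abs_of_nonpos (by linarith), abs_of_nonpos (by linarith)]; ring)
          (mul_nonneg_of_nonpos_of_nonpos (by linarith) (by linarith)) hd
        linarith
  -- the maximum of the exponent is of order `t z`
  have hGz : lam * (t * z) - g x₀ ≤ t * z - g z := by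
    have h2x : 2 * x₀ ≤ z := by nlinarith
    have h1 := htan (show x₀ ≤ z / 2 by linarith) (show x₀ ≤ z by linarith)
    have h2 := htan le_rfl (show x₀ ≤ z / 2 by linarith)
    have h3 := hκ z h2x
    have h4 := hpos (z / 2) (by linarith)
    rw [hz] at h1 h3
    have h5 : deriv g (z / 2) * (z / 2 - x₀) ≤ κ * t * (z / 2) :=
      mul_le_mul h3 (by linarith) (by linarith) (by positivity)
    rw [hlam]
    linarith
  have hr₂0 : 0 < A * r₁ := by positivity
  have hwall : ∀ x, Real.exp (t * x) * p x ≤ K * R * Real.exp (-(|x - z| / (A * r₁))) := by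
    intro x
    rcases le_or_gt x₀ x with hx | hx
    · refine (hwup x hx).trans ?_
      have h1 := hdecay x hx
      have h2 : |x - z| / (A * r₁) ≤ |x - z| / r₁ :=
        div_le_div_of_nonneg_left (abs_nonneg _) hr₁0 (le_mul_of_one_le_left hr₁0.le hA1)
      calc c * Real.exp 1 * Real.exp (t * x - g x)
          ≤ c * Real.exp 1 * Real.exp (1 + (t * z - g z) + -(|x - z| / (A * r₁))) := by
            gcongr; linarith
        _ = c * Real.exp 2 * R * Real.exp (-(|x - z| / (A * r₁))) := by
            rw [Real.exp_add, Real.exp_add, ← hR, show (2 : ℝ) = 1 + 1 by norm_num, Real.exp_add]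
            ring
        _ ≤ _ := by gcongr; exact le_max_left _ _
    · have h1 : |x - z| / (A * r₁) ≤ t * (z - x) * (lam / 2) := by
        rw [abs_of_nonpos (by linarith), div_le_iff₀ hr₂0, hA]
        rw [div_le_iff₀ (by linarith)] at hr₁t
        have h3 : t * (z - x) * (lam / 2) * (2 / lam * r₁) = (z - x) * (r₁ * t) := by
          field_simp
        rw [h3]
        nlinarith
      have h2 : t * x + t * (z - x) * (lam / 2) ≤ g x₀ + (t * z - g z) := by
        have h3 : t * x + t * (z - x) * (lam / 2) = t * (x * (1 - lam / 2) + lam * z / 2) := by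
          ring
        have h4 : x * (1 - lam / 2) ≤ x₀ := by nlinarith
        have h5 : t * (x * (1 - lam / 2) + lam * z / 2) ≤ t * (lam * z) :=
          mul_le_mul_of_nonneg_left (by linarith) (by linarith)
        linarith
      calc Real.exp (t * x) * p x
          ≤ Real.exp (g x₀ + (t * z - g z) + -(|x - z| / (A * r₁))) * M :=
            mul_le_mul (Real.exp_le_exp.2 (by linarith)) (hM.le x) (hp.nonneg x)
              (Real.exp_pos _).le
        _ = M * Real.exp (g x₀) * R * Real.exp (-(|x - z| / (A * r₁))) := by
            rw [Real.exp_add, Real.exp_add, ← hR]; ring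
        _ ≤ _ := by gcongr; exact le_max_right _ _
  refine ⟨z, A * r₁, hr₂0, fun x => ?_⟩
  rw [mul_div_assoc', div_le_iff₀ hφ0]
  refine (mul_le_mul_of_nonneg_left (hwall x) hr₂0.le).trans (le_of_eq ?_)
  rw [hφr, Real.exp_neg 2]
  field_simp

lemma exp_neg_abs_add_le (μ y m : ℝ) (hμ : |μ| ≤ m) :
    Real.exp (-|y + μ|) ≤ Real.exp m * Real.exp (-|y|) := by
  rw [← Real.exp_add]
  refine Real.exp_le_exp.2 ?_
  have := abs_sub_abs_le_abs_sub y (-μ)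
  rw [abs_neg, sub_neg_eq_add] at this
  linarith

/-- For large `t` the tilted density, centred at its mean `a` and rescaled, belongs to one fixed
class of exponentially dominated densities. -/
lemma exists_isExpDominated (hp : IsLightTail p g q c) :
    ∃ C > 0, ∃ t₀ > 0, ∀ t, t₀ ≤ t → ∀ a,
      (Integrable fun x => x * (Real.exp (t * x) * p x)) →
      a = (∫ x, x * (Real.exp (t * x) * p x)) / ∫ x, Real.exp (t * x) * p x →
      ∃ r > 0, IsExpDominated C fun y =>
        r * (Real.exp (t * (a + r * y)) * p (a + r * y) / ∫ x, Real.exp (t * x) * p x) := by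
  obtain ⟨C, hC, t₀, ht₀, H⟩ := hp.exists_rescaled_le
  refine ⟨C * Real.exp (C * expMoment 1), by positivity, t₀, ht₀, fun t ht a hai ha => ?_⟩
  obtain ⟨z, r, hr, hle⟩ := H t ht
  have ht0 : 0 ≤ t := ht₀.le.trans ht
  set φ := ∫ x, Real.exp (t * x) * p x with hφ
  have hφ0 : 0 < φ := hp.integral_exp_mul_pos ht0
  have hwi := hp.integrable_exp_mul ht0
  have hpm := hp.measurable
  have hw0 : ∀ x, 0 ≤ Real.exp (t * x) * p x := fun x =>
    mul_nonneg (Real.exp_pos _).le (hp.nonneg x)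
  have haφ : ∫ x, x * (Real.exp (t * x) * p x) = a * φ := by
    rw [ha, div_mul_cancel₀ _ hφ0.ne']
  -- the distance from the mean to the centre `z` is of order `r`
  have hmean : |(a - z) / r| ≤ C * expMoment 1 := by
    have h1 : (a - z) / r = ∫ x, (x - z) / r * (Real.exp (t * x) * p x / φ) := by
      have h2 : ∀ x, (x - z) / r * (Real.exp (t * x) * p x / φ)
          = (r * φ)⁻¹ * (x * (Real.exp (t * x) * p x) - z * (Real.exp (t * x) * p x)) := by
        intro x; field_simp
      simp only [h2]
      rw [integral_const_mul, integral_sub hai (hwi.const_mul z), integral_const_mul, ← hφ, haφ]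
      field_simp
    have h3 : Integrable fun x => (C / r) * (|(x - z) / r| ^ 1 * Real.exp (-|(x - z) / r|)) :=
      (((integrable_abs_pow_mul_exp_neg_abs 1).comp_div hr.ne').comp_sub_right z).const_mul _
    rw [h1, ← Real.norm_eq_abs]
    refine (norm_integral_le_of_norm_le h3 (Eventually.of_forall fun x => ?_)).trans
      (le_of_eq ?_)
    · have h4 := hle x
      rw [norm_mul, Real.norm_eq_abs, Real.norm_of_nonneg (div_nonneg (hw0 x) hφ0.le), pow_one]
      have h5 : Real.exp (t * x) * p x / φ ≤ C / r * Real.exp (-|(x - z) / r|) := by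
        rw [abs_div, abs_of_pos hr, div_mul_eq_mul_div, le_div_iff₀ hr]
        linarith
      calc _ ≤ |(x - z) / r| * (C / r * Real.exp (-|(x - z) / r|)) := by gcongr
        _ = _ := by ring
    · rw [integral_const_mul,
        integral_sub_right_eq_self (fun x => |x / r| ^ 1 * Real.exp (-|x / r|)) z,
        Measure.integral_comp_div (fun x => |x| ^ 1 * Real.exp (-|x|)) r, smul_eq_mul,
        abs_of_pos hr, expMoment]
      field_simp
  have hcomp : ∀ F : ℝ → ℝ, ∫ y, F (a + r * y) = r⁻¹ * ∫ x, F x := by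
    intro F
    rw [Measure.integral_comp_mul_left (fun x => F (a + x)) r, integral_add_left_eq_self F a,
      abs_of_pos (inv_pos.2 hr), smul_eq_mul]
  refine ⟨r, hr, by fun_prop, fun y => ?_, fun y => ?_, ?_, ?_⟩
  · exact mul_nonneg hr.le (div_nonneg (hw0 _) hφ0.le)
  · refine (hle (a + r * y)).trans ?_
    have h1 : |a + r * y - z| / r = |y + (a - z) / r| := by
      rw [← abs_of_pos hr, ← abs_div, abs_of_pos hr]
      congr 1
      field_simp
      ring
    rw [h1, mul_assoc]
    exact mul_le_mul_of_nonneg_left (exp_neg_abs_add_le _ _ _ hmean) hC.le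
  · rw [hcomp fun x => r * (Real.exp (t * x) * p x / φ), integral_const_mul, integral_div, ← hφ]
    field_simp
  · have h1 : ∀ y, y * (r * (Real.exp (t * (a + r * y)) * p (a + r * y) / φ))
        = (fun x => φ⁻¹ * (x * (Real.exp (t * x) * p x) - a * (Real.exp (t * x) * p x)))
          (a + r * y) := by
      intro y; field_simp; ring
    simp only [h1]
    rw [hcomp fun x => φ⁻¹ * (x * (Real.exp (t * x) * p x) - a * (Real.exp (t * x) * p x)),
      integral_const_mul, integral_sub hai (hwi.const_mul a), integral_const_mul, ← hφ, haφ,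
      sub_self, mul_zero, mul_zero]

end IsLightTail

/-! ### The tilting parameter -/

namespace IsLightTail

variable {p g q : ℝ → ℝ} {c : ℝ}

lemma mem_tiltDomain (hp : IsLightTail p g q c) {t : ℝ} (ht : 0 ≤ t) : t ∈ tiltDomain p := by
  rcases ht.eq_or_lt with rfl | ht
  · exact hp.cramer
  · refine mem_interior.2 ⟨Ioi 0, fun s hs => ?_, isOpen_Ioi, ht⟩
    exact (integrable_law_iff hp.measurable hp.nonneg _).2 (hp.integrable_exp_mul (mem_Ioi.1 hs).le)

lemma integrable_mul_exp_mul (hp : IsLightTail p g q c) {t : ℝ} (ht : t ∈ tiltDomain p) :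
    Integrable fun x => x * (Real.exp (t * x) * p x) := by
  have h := integrable_pow_mul_exp_of_mem_interior_integrableExpSet ht 1
  have := (integrable_law_iff hp.measurable hp.nonneg _).1 h
  simpa [mul_assoc] using this

lemma tiltMean_eq (hp : IsLightTail p g q c) {t : ℝ} (ht : t ∈ tiltDomain p) :
    tiltMean p t
      = (∫ x, x * (Real.exp (t * x) * p x)) / ∫ x, Real.exp (t * x) * p x := by
  rw [tiltMean, deriv_cgf ht, hp.mgf_eq, integral_law hp.measurable hp.nonneg]
  simp only [id_eq, mul_assoc]

lemma convex_tiltDomain : Convex ℝ (tiltDomain p) := convex_integrableExpSet.interior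

lemma continuousOn_tiltMean : ContinuousOn (tiltMean p) (tiltDomain p) :=
  (analyticOnNhd_cgf (X := id) (μ := law p)).deriv.continuousOn

/-- The derivative of the tilted mean is the variance of the tilted law, which is positive because
a law with a density is not a point mass. -/
lemma strictMonoOn_tiltMean (hp : IsLightTail p g q c) :
    StrictMonoOn (tiltMean p) (tiltDomain p) := by
  have hprob := hp.isProbabilityMeasure
  refine strictMonoOn_of_deriv_pos convex_tiltDomain continuousOn_tiltMean fun t ht => ?_
  have ht' : t ∈ interior (integrableExpSet id (law p)) := interior_subset ht
  have h1 : deriv (tiltMean p) t = iteratedDeriv 2 (cgf id (law p)) t := by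
    rw [iteratedDeriv_succ, iteratedDeriv_one]; rfl
  rw [h1, iteratedDeriv_two_cgf_eq_integral ht']
  refine div_pos ?_ (mgf_pos (interior_subset (s := integrableExpSet id (law p)) ht'))
  set m := deriv (cgf id (law p)) t
  have hint : Integrable (fun x : ℝ => (id x - m) ^ 2 * Real.exp (t * id x)) (law p) := by
    have e2 := integrable_pow_mul_exp_of_mem_interior_integrableExpSet ht' 2
    have e1 := integrable_pow_mul_exp_of_mem_interior_integrableExpSet ht' 1
    have e0 := integrable_pow_mul_exp_of_mem_interior_integrableExpSet ht' 0
    refine ((e2.sub (e1.const_mul (2 * m))).add (e0.const_mul (m ^ 2))).congr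
      (Eventually.of_forall fun x => ?_)
    simp only [Pi.add_apply, Pi.sub_apply, id_eq]
    ring
  rw [integral_pos_iff_support_of_nonneg (fun x => by positivity) hint]
  have hsupp : Function.support (fun x : ℝ => (id x - m) ^ 2 * Real.exp (t * id x)) = {m}ᶜ := by
    ext x
    simp [sub_eq_zero]
  have h0 : law p {m} = 0 := by
    rw [law]
    exact withDensity_absolutelyContinuous _ _ (measure_singleton m)
  rw [hsupp, prob_compl_eq_one_sub (measurableSet_singleton m), h0]
  simp

/-- The tilted mean is unbounded: otherwise `φ(t) ≤ exp (A t)` for all `t ≥ 0`, and `p` would have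
no mass beyond `A + 1`. -/
lemma exists_lt_tiltMean (hp : IsLightTail p g q c) (A : ℝ) : ∃ t ≥ 0, A < tiltMean p t := by
  have hprob := hp.isProbabilityMeasure
  by_contra! hcon
  set B := max (A + 1) 1 with hB
  have hmem : ∀ t, 0 ≤ t → Integrable (fun x : ℝ => Real.exp (t * id x)) (law p) := fun t ht =>
    interior_subset (s := integrableExpSet id (law p)) (hp.mem_tiltDomain ht)
  have hcgf : ∀ t, 0 ≤ t → cgf id (law p) t ≤ A * t := by
    intro t ht
    have h := (convex_Ici (0 : ℝ)).image_sub_le_mul_sub_of_deriv_le (f := cgf id (law p)) (C := A)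
      (fun s hs => (analyticAt_cgf (hp.mem_tiltDomain hs)).continuousAt.continuousWithinAt)
      (fun s hs => (analyticAt_cgf
        (hp.mem_tiltDomain (interior_subset hs))).differentiableAt.differentiableWithinAt)
      (fun s hs => hcon s (interior_subset hs)) 0 self_mem_Ici t ht ht
    simpa using h
  have hbound : ∀ t, 0 ≤ t → (law p).real {x | B ≤ id x} ≤ Real.exp (-t) := by
    intro t ht
    refine (measure_ge_le_exp_mul_mgf B ht (hmem t ht)).trans ?_
    rw [← exp_cgf (hmem t ht), ← Real.exp_add]
    refine Real.exp_le_exp.2 ?_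
    have := mul_le_mul_of_nonneg_left (le_max_left (A + 1) 1) ht
    linarith [hcgf t ht]
  have hzero : (law p).real {x | B ≤ id x} ≤ 0 :=
    ge_of_tendsto (Real.tendsto_exp_neg_atTop_nhds_zero)
      ((eventually_ge_atTop 0).mono fun t ht => hbound t ht)
  have hz : law p {x | B ≤ id x} = 0 := by
    rw [← measureReal_eq_zero_iff]
    exact le_antisymm hzero measureReal_nonneg
  rw [law, withDensity_apply _ (measurableSet_le measurable_const measurable_id),
    setLIntegral_eq_zero_iff (measurableSet_le measurable_const measurable_id)
      hp.measurable.ennreal_ofReal] at hz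
  have hpos : ∀ x, x ∈ {x : ℝ | B ≤ id x} → ¬ ENNReal.ofReal (p x) = 0 := by
    intro x hx
    have hx0 : 0 < x := by
      have : B ≤ x := hx
      linarith [le_max_right (A + 1) 1]
    rw [ENNReal.ofReal_eq_zero, not_le, hp.density_eq x hx0]
    have := hp.c_pos
    positivity
  have hnull : volume {x : ℝ | B ≤ id x} = 0 := by
    refine measure_mono_null (fun x hx => ?_) hz
    exact fun h => hpos x hx (h hx)
  rw [show {x : ℝ | B ≤ id x} = Ici B from rfl, Real.volume_Ici] at hnull
  exact ENNReal.top_ne_zero hnull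

lemma exists_tiltMean_eq (hp : IsLightTail p g q c) {T a : ℝ} (hT : 0 ≤ T)
    (ha : tiltMean p T < a) : ∃ t, T < t ∧ tiltMean p t = a := by
  obtain ⟨s, hs, has⟩ := hp.exists_lt_tiltMean a
  have hTs : T ≤ s := by
    by_contra! h
    have := hp.strictMonoOn_tiltMean (hp.mem_tiltDomain hs) (hp.mem_tiltDomain hT) h
    linarith
  obtain ⟨t, ht, hta⟩ := intermediate_value_Ioo hTs
    (continuousOn_tiltMean.mono fun u hu => hp.mem_tiltDomain (hT.trans hu.1)) ⟨ha, has⟩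
  exact ⟨t, ht.1, hta⟩

lemma tiltParam_spec (hp : IsLightTail p g q c) {T a : ℝ} (hT : 0 ≤ T) (ha : tiltMean p T < a) :
    T < tiltParam p a ∧ tiltMean p (tiltParam p a) = a ∧
      ∃! t : ℝ, t ∈ tiltDomain p ∧ tiltMean p t = a := by
  obtain ⟨t, hTt, hta⟩ := hp.exists_tiltMean_eq hT ha
  have htD := hp.mem_tiltDomain (hT.trans hTt.le)
  have hex : ∃ t ∈ tiltDomain p, tiltMean p t = a := ⟨t, htD, hta⟩
  have hmem : tiltParam p a ∈ tiltDomain p := Function.invFunOn_mem hex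
  have heq : tiltMean p (tiltParam p a) = a := Function.invFunOn_eq hex
  have hinj := hp.strictMonoOn_tiltMean.injOn
  have htt : tiltParam p a = t := hinj hmem htD (heq.trans hta.symm)
  exact ⟨htt ▸ hTt, heq, t, ⟨htD, hta⟩, fun s hs => hinj hs.1 htD (hs.2.trans hta.symm)⟩

end IsLightTail

/-! ### Conditioning, tilting and affine changes of variable -/

lemma integral_comp_affine (F : ℝ → ℝ) (a : ℝ) {r : ℝ} (hr : 0 < r) :
    ∫ y, r * F (a + r * y) = ∫ x, F x := by
  rw [integral_const_mul, Measure.integral_comp_mul_left (fun x => F (a + x)) r,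
    integral_add_left_eq_self F a, abs_of_pos (inv_pos.2 hr), smul_eq_mul,
    mul_inv_cancel_left₀ hr.ne']

/-- Exponential tilting and affine rescaling commute with convolution powers. -/
lemma sumDensity_tilted_affine (p : ℝ → ℝ) (t a φ : ℝ) {r : ℝ} (hr : 0 < r) : ∀ n, 1 ≤ n → ∀ y,
    sumDensity (fun y => r * (Real.exp (t * (a + r * y)) * p (a + r * y) / φ)) n y
      = r * (Real.exp (t * (n * a + r * y)) * sumDensity p n (n * a + r * y) / φ ^ n)
  | 1, _, y => by simp [sumDensity]
  | n + 2, _, y => by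
    rw [sumDensity_succ (by omega), sumDensity_succ (f := p) (by omega),
      ← integral_comp_affine (fun x => p x * sumDensity p (n + 2 - 1)
        (((n + 2 : ℕ) : ℝ) * a + r * y - x)) a hr, ← integral_const_mul, ← integral_div,
      ← integral_const_mul]
    refine integral_congr_ae (Eventually.of_forall fun u => ?_)
    simp only [Nat.add_succ_sub_one]
    rw [sumDensity_tilted_affine p t a φ hr (n + 1) (by omega)]
    have h1 : ((n + 2 : ℕ) : ℝ) * a + r * y - (a + r * u)
        = ((n + 1 : ℕ) : ℝ) * a + r * (y - u) := by
      push_cast; ring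
    have h2 : Real.exp (t * (((n + 2 : ℕ) : ℝ) * a + r * y)) = Real.exp (t * (a + r * u)) *
        Real.exp (t * (((n + 1 : ℕ) : ℝ) * a + r * (y - u))) := by
      rw [← Real.exp_add]; congr 1; push_cast; ring
    rw [h1, h2, pow_succ φ (n + 1)]
    ring

/-- The conditional density of a summand is unchanged by exponential tilting. -/
lemma mul_condDensity_eq (p : ℝ → ℝ) {t a φ r : ℝ} (hφ : φ ≠ 0) (hr : 0 < r) {n : ℕ} (hn : 2 ≤ n)
    {f : ℝ → ℝ} (hf : f = fun y => r * (Real.exp (t * (a + r * y)) * p (a + r * y) / φ)) (y : ℝ) :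
    r * condDensity p n a (a + r * y)
      = f y * sumDensity f (n - 1) (-y) / sumDensity f n 0 := by
  obtain ⟨k, rfl⟩ := Nat.exists_eq_add_of_le' hn
  rw [hf, sumDensity_tilted_affine p t a φ hr _ (by omega),
    sumDensity_tilted_affine p t a φ hr _ (by omega), condDensity, jointDensity]
  simp only [Nat.add_succ_sub_one, mul_zero, add_zero]
  have h1 : ((k + 2 : ℕ) : ℝ) * a - (a + r * y) = ((k + 1 : ℕ) : ℝ) * a + r * -y := by
    push_cast; ring
  have h2 : Real.exp (t * (((k + 2 : ℕ) : ℝ) * a)) = Real.exp (t * (a + r * y)) *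
      Real.exp (t * (((k + 1 : ℕ) : ℝ) * a + r * -y)) := by
    rw [← Real.exp_add]; congr 1; push_cast; ring
  rw [h1, h2, pow_succ φ (k + 1)]
  field_simp

lemma isProbabilityMeasure_law {p : ℝ → ℝ} (h0 : ∀ x, 0 ≤ p x) (hi : Integrable p)
    (h1 : ∫ x, p x = 1) : IsProbabilityMeasure (law p) := by
  refine ⟨?_⟩
  rw [law, withDensity_apply _ MeasurableSet.univ, Measure.restrict_univ,
    ← ofReal_integral_eq_lintegral_ofReal hi (Eventually.of_forall h0), h1, ENNReal.ofReal_one]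

lemma law_real_apply {p : ℝ → ℝ} (h0 : ∀ x, 0 ≤ p x) (hi : Integrable p) {S : Set ℝ}
    (hS : MeasurableSet S) : (law p).real S = ∫ x in S, p x := by
  rw [measureReal_def, law, withDensity_apply _ hS,
    integral_eq_lintegral_of_nonneg_ae (Eventually.of_forall h0) hi.aestronglyMeasurable.restrict]

lemma tvDist_nonneg (μ ν : Measure ℝ) : 0 ≤ tvDist μ ν := Real.iSup_nonneg fun _ => abs_nonneg _

/-- The total variation distance is at most the `L¹` distance of the densities. -/
lemma tvDist_law_le {u w : ℝ → ℝ} (hu0 : ∀ x, 0 ≤ u x) (hw0 : ∀ x, 0 ≤ w x) (hu : Integrable u)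
    (hw : Integrable w) : tvDist (law u) (law w) ≤ ∫ x, |u x - w x| := by
  refine Real.iSup_le (fun S => ?_) (integral_nonneg fun _ => abs_nonneg _)
  rw [law_real_apply hu0 hu S.2, law_real_apply hw0 hw S.2,
    ← integral_sub hu.integrableOn hw.integrableOn]
  refine abs_integral_le_integral_abs.trans ?_
  exact setIntegral_le_integral (hu.sub hw).abs (Eventually.of_forall fun _ => abs_nonneg _)

/-- Quantitative form of the conditional limit: for large `n` the conditional and the tilted
densities are probability densities at `L¹` distance `O(1 / √n)`, uniformly in large `a`. -/
theorem IsLightTail.exists_integral_abs_condDensity_sub_le {p g q : ℝ → ℝ} {c : ℝ}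
    (hp : IsLightTail p g q c) :
    ∃ D a₀ : ℝ, ∀ᶠ n : ℕ in atTop, ∀ a, a₀ < a →
      (∃! t : ℝ, t ∈ tiltDomain p ∧ tiltMean p t = a) ∧
      ((∀ x, 0 ≤ tiltedDensity p a x) ∧ Integrable (tiltedDensity p a) ∧
        ∫ x, tiltedDensity p a x = 1) ∧
      ((∀ x, 0 ≤ condDensity p n a x) ∧ Integrable (condDensity p n a) ∧
        ∫ x, condDensity p n a x = 1) ∧
      ∫ x, |condDensity p n a x - tiltedDensity p a x| ≤ D / √n := by
  obtain ⟨C, hC, T, hT, hdom⟩ := hp.exists_isExpDominated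
  obtain ⟨D, hD⟩ := exists_integral_abs_cond_sub_le hC
  obtain ⟨M, hM⟩ := hp.isBddDensity
  refine ⟨D, tiltMean p T, ?_⟩
  filter_upwards [hD, eventually_ge_atTop 2] with n hn hn2 a ha
  obtain ⟨hTt, hta, huniq⟩ := hp.tiltParam_spec hT.le ha
  set t := tiltParam p a with ht
  have ht0 : 0 ≤ t := hT.le.trans hTt.le
  have htD := hp.mem_tiltDomain ht0
  obtain ⟨r, hr, hfd⟩ := hdom t hTt.le a (hp.integrable_mul_exp_mul htD)
    (hta ▸ hp.tiltMean_eq htD)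
  set φ := ∫ x, Real.exp (t * x) * p x with hφ
  have hφ0 : 0 < φ := hp.integral_exp_mul_pos ht0
  have htilt : ∀ x, tiltedDensity p a x = Real.exp (t * x) * p x / φ := fun x => by
    rw [tiltedDensity, ← ht, hp.mgf_eq, ← hφ]; ring
  obtain ⟨hSpos, hL1⟩ := hn _ hfd
  set f : ℝ → ℝ := fun y => r * (Real.exp (t * (a + r * y)) * p (a + r * y) / φ) with hf
  have hS := hM.sumDensity (n - 1) (by omega)
  have hSn : 0 < sumDensity p n (n * a) := by
    rw [hf, sumDensity_tilted_affine p t a φ hr n (by omega), mul_zero, add_zero] at hSpos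
    by_contra! h
    have h0 := le_antisymm h ((hM.sumDensity n (by omega)).nonneg _)
    rw [h0] at hSpos
    simp at hSpos
  refine ⟨huniq, ⟨fun x => ?_, ?_, ?_⟩, ⟨fun x => ?_, ?_, ?_⟩, ?_⟩
  · rw [htilt]
    exact div_nonneg (mul_nonneg (Real.exp_pos _).le (hp.nonneg x)) hφ0.le
  · exact ((hp.integrable_exp_mul ht0).div_const φ).congr
      (Eventually.of_forall fun x => (htilt x).symm)
  · simp only [htilt]
    rw [integral_div, ← hφ, div_self hφ0.ne']
  · exact div_nonneg (mul_nonneg (hp.nonneg x) (hS.nonneg _)) hSn.le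
  · exact (hM.integrable_mul hS (n * a)).div_const _
  · simp only [condDensity, jointDensity]
    rw [integral_div, ← sumDensity_succ hn2, div_self hSn.ne']
  · rw [← integral_comp_affine _ a hr]
    refine le_trans (le_of_eq (integral_congr_ae (Eventually.of_forall fun y => ?_))) hL1
    simp only
    rw [← mul_condDensity_eq p hφ0.ne' hr hn2 hf, htilt, ← mul_sub, abs_mul, abs_of_pos hr]

end GibbsED

end

theorem mainTheorem1 (p g q : ℝ → ℝ) (c : ℝ) (hp : GibbsED.IsLightTail p g q c)
    (a : ℕ → ℝ) (ha : Tendsto a atTop atTop)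
    (hgrowth : Tendsto (fun n : ℕ =>
      GibbsED.psi (deriv g) (GibbsED.tiltParam p (a n)) ^ 2 /
        √((n : ℝ) * deriv (GibbsED.psi (deriv g)) (GibbsED.tiltParam p (a n)))) atTop (𝓝 0)) :
    (∀ᶠ n : ℕ in atTop,
      (∃! t : ℝ, t ∈ GibbsED.tiltDomain p ∧ GibbsED.tiltMean p t = a n) ∧
      IsProbabilityMeasure (GibbsED.tiltedLaw p (a n)) ∧
      IsProbabilityMeasure (GibbsED.condLaw p n (a n))) ∧
    Tendsto (fun n : ℕ => GibbsED.tvDist (GibbsED.condLaw p n (a n)) (GibbsED.tiltedLaw p (a n)))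
      atTop (𝓝 0) ∧
    Tendsto (fun n : ℕ => ∫⁻ x, ENNReal.ofReal
      |GibbsED.condDensity p n (a n) x - GibbsED.tiltedDensity p (a n) x|) atTop (𝓝 0) := by
  -- an `O(1 / √n)` bound for the `L¹` distance, uniform in large `a`
  obtain ⟨D, a₀, hD⟩ := hp.exists_integral_abs_condDensity_sub_le
  have hev := hD.and (ha.eventually_gt_atTop a₀)
  have hlim : Tendsto (fun n : ℕ => D / √(n : ℝ)) atTop (𝓝 0) :=
    tendsto_const_nhds.div_atTop (Real.tendsto_sqrt_atTop.comp tendsto_natCast_atTop_atTop)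
  refine ⟨?_, ?_, ?_⟩
  · filter_upwards [hev] with n hn
    obtain ⟨huniq, ⟨h1, h2, h3⟩, ⟨h4, h5, h6⟩, -⟩ := hn.1 (a n) hn.2
    exact ⟨huniq, GibbsED.isProbabilityMeasure_law h1 h2 h3,
      GibbsED.isProbabilityMeasure_law h4 h5 h6⟩
  · refine tendsto_of_tendsto_of_tendsto_of_le_of_le' tendsto_const_nhds hlim
      (Eventually.of_forall fun n => GibbsED.tvDist_nonneg _ _) ?_
    filter_upwards [hev] with n hn
    obtain ⟨-, ⟨h1, h2, -⟩, ⟨h4, h5, -⟩, h7⟩ := hn.1 (a n) hn.2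
    exact (GibbsED.tvDist_law_le h4 h1 h5 h2).trans h7
  · have hlim' := ENNReal.tendsto_ofReal hlim
    rw [ENNReal.ofReal_zero] at hlim'
    refine tendsto_of_tendsto_of_tendsto_of_le_of_le' tendsto_const_nhds hlim'
      (Eventually.of_forall fun n => zero_le) ?_
    filter_upwards [hev] with n hn
    obtain ⟨-, ⟨-, h2, -⟩, ⟨-, h5, -⟩, h7⟩ := hn.1 (a n) hn.2
    have h8 := ofReal_integral_eq_lintegral_ofReal (h5.sub h2).abs
      (Eventually.of_forall fun _ => abs_nonneg _)
    simp only [Pi.sub_apply] at h8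
    rw [← h8]
    exact ENNReal.ofReal_le_ofReal h7
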